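/- For points $a,b,c\in\mathbb R^2$ the orientation of $(a,b,c)$ is the sign of $\det\begin{pmatrix}a_x&b_x&c_x\\a_y&b_y&c_y\\1&1&1\end{pmatrix}$, and the chirotope of a sequence $P=(p_1,\dots,p_n)$ of points of the plane is the map that sends $(i,j,k)$ to the orientation of $(p_i,p_j,p_k)$. A sequence of points of $[0,1]^2$ is given as $2n$ infinite binary strings, one binary expansion for each coordinate of each point. A (deterministic) algorithm chooses at each step, depending on the bits read so far, either a coordinate of a point, whose next bit (in order, starting from the most significant one) it then reads at unit cost, or it stops and announces a chirotope; all other computations are free. Let $P$ be a sequence of $n$ points drawn independently and uniformly in $[0,1]^2$. An algorithm determines the chirotope of $P$ if almost surely it stops and announces the chirotope of $P$. The greedy method reads bits as follows. At any time the known bits of $p_i$ determine a closed dyadic square cell that contains $p_i$ (initially $[0,1]^2$). As long as there are distinct indices $a,b,c$ such that some line meets the three cells known to contain $p_a,p_b,p_c$, it picks such a triple and, among its three points, one with the fewest known bits, and reads one more bit of both coordinates of this point (first $x$, then $y$); ties are broken arbitrarily. When there is no such triple, it stops and announces the chirotope, which is then the same for all sequences of points in the known cells. Theorem. Logarithms are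 to base $2$. (i) There is a constant $C$ such that for every $n\ge 3$, every algorithm that determines the chirotope of $P$ reads on average at least $4n\log n-C\,n\log\log n$ coordinate bits. (ii) There is a (Turing-computable, uniformly in $n$) algorithm that follows the greedy method. Moreover, for every $n\ge 0$, every algorithm that follows the greedy method, whatever its rule to break ties, determines the chirotope of $P$, stops with the right chirotope on every input in which no three points are aligned, and reads on average at most $4n\log n+16n$ coordinate bits (where $0\log 0=0$), hence $4n\log n+O(n)$. -/

import Mathlib

open MeasureTheory
open scoped ENNReal

namespace BitModel

noncomputable section

/-! ### Orientations and chirotopes -/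

/-- The orientation of a triple of points of the plane: `1` if the triangle is oriented
counterclockwise, `-1` if it is oriented clockwise, `0` if it is flat. -/
def orientation (a b c : Fin 2 → ℝ) : SignType :=
  SignType.sign (Matrix.det !![a 0, b 0, c 0; a 1, b 1, c 1; 1, 1, 1])

/-- The type of all assignments of a sign to each triple of indices. -/
abbrev Signs (n : ℕ) : Type := Fin n → Fin n → Fin n → SignType

/-- The chirotope of a sequence of `n` points: the orientations of all its triples.
Two sequences have the same chirotope (as an equivalence class) iff these functions agree. -/
def chirotope {n : ℕ} (P : Fin n → Fin 2 → ℝ) : Signs n :=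
  fun i j k => orientation (P i) (P j) (P k)

/-- No three points (with distinct indices) are aligned. -/
def InGeneralPosition {n : ℕ} (P : Fin n → Fin 2 → ℝ) : Prop :=
  ∀ i j k : Fin n, i ≠ j → j ≠ k → i ≠ k → chirotope P i j k ≠ 0

/-! ### Uniform samples and binary expansions -/

/-- The uniform distribution on the unit square. -/
def uniformSquare : Measure (Fin 2 → ℝ) := volume.restrict (Set.Icc 0 1)

/-- The law of a uniform sample of size `n`: `n` independent uniform points of `[0,1]²`. -/
def uniformSample (n : ℕ) : Measure (Fin n → Fin 2 → ℝ) :=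
  Measure.pi fun _ => uniformSquare

/-- The binary digits of `x ∈ [0,1]` after the point, the most significant one first.
The real `1` is written `0.111…`. -/
def bits (x : ℝ) : ℕ → Fin 2 :=
  if x = 1 then fun _ => 1 else Real.digits x 2

/-- An input: `2 n` infinite binary strings, one per point and coordinate. -/
abbrev Input (n : ℕ) : Type := Fin n → Fin 2 → ℕ → Fin 2

/-- The points described by an input. Either expansion of a dyadic number may be used. -/
def Input.points {n : ℕ} (w : Input n) : Fin n → Fin 2 → ℝ :=
  fun i c => Real.ofDigits (w i c)

/-- The input that describes a sequence of points of `[0,1]²`. -/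
def inputOf {n : ℕ} (P : Fin n → Fin 2 → ℝ) : Input n := fun i c => bits (P i c)

/-! ### Algorithms that read coordinate bits -/

/-- What has been read so far: a finite prefix of each of the `2 n` strings. -/
abbrev Knowledge (n : ℕ) : Type := Fin n → Fin 2 → List (Fin 2)

/-- What an algorithm can do: read the next bit of coordinate `c` of point `i`
(at unit cost), or stop and announce a chirotope. -/
inductive Action (n : ℕ) : Type
  | read (i : Fin n) (c : Fin 2) : Action n
  | output (χ : Signs n) : Action n

/-- A deterministic algorithm, up to the computations that it performs for free: its next action
is a function of what it has read. (Along the runs of a deterministic algorithm the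
prefixes that are known determine the order in which they were read, so nothing is lost by
letting the next action depend on the prefixes alone.) -/
abbrev Algorithm (n : ℕ) : Type := Knowledge n → Action n

/-- The knowledge of the algorithm `A` on the input `w` after `t` steps; it does not change once
`A` has stopped. -/
def knowledge {n : ℕ} (A : Algorithm n) (w : Input n) : ℕ → Knowledge n
  | 0 => fun _ _ => []
  | t + 1 =>
    match A (knowledge A w t) with
    | Action.read i c => fun j d =>
        if j = i ∧ d = c then
          knowledge A w t j d ++ [w j d (knowledge A w t j d).length]
        else knowledge A w t j d
    | Action.output _ => knowledge A w t

/-- On the input `w`, the algorithm `A` stops and announces `χ`. -/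
def Outputs {n : ℕ} (A : Algorithm n) (w : Input n) (χ : Signs n) : Prop :=
  ∃ t, A (knowledge A w t) = Action.output χ

/-- The total number of coordinate bits that `A` reads on the input `w`
(`∞` if `A` does not stop). -/
def bitsRead {n : ℕ} (A : Algorithm n) (w : Input n) : ℝ≥0∞ :=
  ⨆ t : ℕ, ((∑ i, ∑ c, (knowledge A w t i c).length : ℕ) : ℝ≥0∞)

/-- The average number of coordinate bits that `A` reads on a uniform sample of size `n`. -/
def averageBits {n : ℕ} (A : Algorithm n) : ℝ≥0∞ :=
  ∫⁻ P, bitsRead A (inputOf P) ∂(uniformSample n)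

/-- The algorithm `A` determines the chirotope of a uniform sample: almost surely, it stops and
announces the right chirotope. -/
def DeterminesChirotope {n : ℕ} (A : Algorithm n) : Prop :=
  ∀ᵐ P ∂(uniformSample n), Outputs A (inputOf P) (chirotope P)

/-- An action as a finite piece of data. -/
def Action.code {n : ℕ} : Action n → (ℕ × ℕ) ⊕ List (List (List ℤ))
  | Action.read i c => Sum.inl ((i : ℕ), (c : ℕ))
  | Action.output χ => Sum.inr
      (List.ofFn fun i => List.ofFn fun j => List.ofFn fun k => ((χ i j k : SignType) : ℤ))

/-- A family of algorithms, one for each size, is computable if a single Turing-computable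
function, applied to the list of the pairs of known prefixes, gives the next action. -/
def UniformlyComputable (A : ∀ n, Algorithm n) : Prop :=
  ∃ f : List (List (Fin 2) × List (Fin 2)) → (ℕ × ℕ) ⊕ List (List (List ℤ)),
    Computable f ∧
    ∀ (n : ℕ) (K : Knowledge n), f (List.ofFn fun i => (K i 0, K i 1)) = (A n K).code

/-! ### The greedy method -/

/-- The dyadic number `0.b₁b₂…bₖ` of a finite binary string. -/
def prefixValue : List (Fin 2) → ℝ
  | [] => 0
  | b :: u => (((b : ℕ) : ℝ) + prefixValue u) / 2

/-- The cell known to contain point `i`: all points of the square whose coordinates have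
binary expansions that start with the known prefixes. -/
def knownCell {n : ℕ} (K : Knowledge n) (i : Fin n) : Set (Fin 2 → ℝ) :=
  {p | ∀ c, p c ∈ Set.Icc (prefixValue (K i c))
    (prefixValue (K i c) + (1 / 2 : ℝ) ^ (K i c).length)}

/-- The three indices are distinct and some line `{x + t • v}` meets the three cells known to
contain the points. -/
def Unresolved {n : ℕ} (K : Knowledge n) (a b c : Fin n) : Prop :=
  a ≠ b ∧ b ≠ c ∧ a ≠ c ∧
    ∃ x v : Fin 2 → ℝ, v ≠ 0 ∧
      (∃ t : ℝ, x + t • v ∈ knownCell K a) ∧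
      (∃ t : ℝ, x + t • v ∈ knownCell K b) ∧
      (∃ t : ℝ, x + t • v ∈ knownCell K c)

/-- For each point, equally many bits of its two coordinates are known. -/
def Balanced {n : ℕ} (K : Knowledge n) : Prop :=
  ∀ i, (K i 0).length = (K i 1).length

/-- `A` follows the greedy method, with any rule to break ties: as long as there is an unresolved
triple, it selects a point of coarsest resolution in some unresolved triple
and reads one more bit of both coordinates of this point; when there is none, it
stops and announces the chirotope common to all sequences of points that agree with what is
known. -/
structure IsGreedy {n : ℕ} (A : Algorithm n) : Prop where
  select : ∀ K : Knowledge n, Balanced K → (∃ a b c, Unresolved K a b c) →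
    ∃ a b c, Unresolved K a b c ∧
      (K a 0).length ≤ (K b 0).length ∧ (K a 0).length ≤ (K c 0).length ∧
      A K = Action.read a 0
  second : ∀ (K : Knowledge n) (i : Fin n), (K i 0).length = (K i 1).length + 1 →
    (∀ j, j ≠ i → (K j 0).length = (K j 1).length) → A K = Action.read i 1
  finish : ∀ K : Knowledge n, Balanced K → (¬ ∃ a b c, Unresolved K a b c) →
    ∃ χ : Signs n, A K = Action.output χ ∧
      ∀ P : Fin n → Fin 2 → ℝ, (∀ i, P i ∈ knownCell K i) → chirotope P = χ

end

end BitModel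

open BitModel

/-!
The signed area of a triple is affine in each point, so three dyadic cells meet a common line if and
only if the signed areas of the triangles spanned by their corners do not all have the same strict
sign. This test needs only integer arithmetic, which makes the greedy method computable.

Upper bound: the greedy method reads the bit after the first `r` bits of a coordinate of a point
only if some two other points span a line that passes within `O(2 ^ (-r))` of this point, which has
probability `O(n ^ 2 * 2 ^ (-r))`. The sum of `min 1 (c * n ^ 2 * 2 ^ (-r))` over `r` is
`2 * log n + O(1)`, and there are `2 * n` coordinates.

Lower bound: an algorithm that stops correctly cannot leave a coordinate of a point so uncertain
that a line through two other points crosses the dyadic segment in which this coordinate may still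
vary. By the second moment method, a segment of length about `log n / n ^ 2` is crossed with
probability `1 - O(1 / log n)`, so most coordinates need more than `2 * log n - log log n` bits.
-/

namespace BitModel

/-! ### Binary strings and dyadic intervals -/

/-- The first `k` letters of the infinite string `s`. -/
def streamPrefix (s : ℕ → Fin 2) (k : ℕ) : List (Fin 2) := (List.range k).map s

/-- The closed interval of the numbers that have a binary expansion starting with `u`. -/
def dyadicInterval (u : List (Fin 2)) : Set ℝ :=
  Set.Icc (prefixValue u) (prefixValue u + (1 / 2 : ℝ) ^ u.length)

@[simp] lemma length_streamPrefix (s : ℕ → Fin 2) (k : ℕ) : (streamPrefix s k).length = k := by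
  simp [streamPrefix]

lemma streamPrefix_succ (s : ℕ → Fin 2) (k : ℕ) :
    streamPrefix s (k + 1) = streamPrefix s k ++ [s k] := by
  simp [streamPrefix, List.range_succ]

lemma streamPrefix_eq_iff {s s' : ℕ → Fin 2} {k : ℕ} :
    streamPrefix s k = streamPrefix s' k ↔ ∀ j < k, s j = s' j := by
  simp [streamPrefix]

lemma streamPrefix_prefix (s : ℕ → Fin 2) {k l : ℕ} (h : k ≤ l) :
    streamPrefix s k <+: streamPrefix s l := by
  rw [List.prefix_iff_eq_take, length_streamPrefix, streamPrefix, streamPrefix, ← List.map_take,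
    List.take_range, min_eq_left h]

lemma natCast_bit_le_one (b : Fin 2) : ((b : ℕ) : ℝ) ≤ 1 := by exact_mod_cast b.is_le

lemma prefixValue_nonneg (u : List (Fin 2)) : 0 ≤ prefixValue u := by
  induction u with
  | nil => exact le_rfl
  | cons a u ih => simp only [prefixValue]; positivity

lemma prefixValue_add_le_one (u : List (Fin 2)) : prefixValue u + (1 / 2 : ℝ) ^ u.length ≤ 1 := by
  induction u with
  | nil => simp [prefixValue]
  | cons a u ih =>
    simp only [prefixValue, List.length_cons, pow_succ]
    linarith [natCast_bit_le_one a]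

lemma prefixValue_append (u v : List (Fin 2)) :
    prefixValue (u ++ v) = prefixValue u + (1 / 2) ^ u.length * prefixValue v := by
  induction u with
  | nil => simp [prefixValue]
  | cons a u ih => simp only [List.cons_append, prefixValue, ih, List.length_cons]; ring

lemma dyadicInterval_subset_of_prefix {u v : List (Fin 2)} (h : u <+: v) :
    dyadicInterval v ⊆ dyadicInterval u := by
  obtain ⟨w, rfl⟩ := h
  have hu : (0 : ℝ) < (1 / 2) ^ u.length := by positivity
  have h0 := mul_nonneg hu.le (prefixValue_nonneg w)
  have h1 := mul_le_mul_of_nonneg_left (prefixValue_add_le_one w) hu.le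
  apply Set.Icc_subset_Icc <;> rw [prefixValue_append]
  · linarith
  · rw [List.length_append, pow_add]
    linarith

lemma eq_of_prefixValue_lt {u v : List (Fin 2)} (hlen : u.length = v.length)
    (huv : prefixValue u < prefixValue v + (1 / 2) ^ v.length)
    (hvu : prefixValue v < prefixValue u + (1 / 2) ^ u.length) : u = v := by
  induction u generalizing v with
  | nil => exact (List.length_eq_zero_iff.1 hlen.symm).symm
  | cons a u ih =>
    obtain - | ⟨b, v⟩ := v
    · simp at hlen
    have hlen' : u.length = v.length := by simpa using hlen
    simp only [prefixValue, List.length_cons, pow_succ] at huv hvu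
    have hab : ((a : ℕ) : ℝ) < (b : ℕ) + 1 := by
      linarith [prefixValue_nonneg u, prefixValue_add_le_one v]
    have hba : ((b : ℕ) : ℝ) < (a : ℕ) + 1 := by
      linarith [prefixValue_nonneg v, prefixValue_add_le_one u]
    obtain rfl : a = b := by
      norm_cast at hab hba
      lia
    rw [ih hlen' (by linarith) (by linarith)]

lemma prefixValue_streamPrefix (s : ℕ → Fin 2) (k : ℕ) :
    prefixValue (streamPrefix s k) = ∑ i ∈ Finset.range k, Real.ofDigitsTerm s i := by
  induction k with
  | zero => simp [streamPrefix, prefixValue]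
  | succ k ih =>
    rw [streamPrefix_succ, prefixValue_append, ih, Finset.sum_range_succ, length_streamPrefix,
      Real.ofDigitsTerm]
    simp [prefixValue, pow_succ, div_eq_mul_inv, mul_comm, mul_assoc]

lemma ofDigits_mem_dyadicInterval (s : ℕ → Fin 2) (k : ℕ) :
    Real.ofDigits s ∈ dyadicInterval (streamPrefix s k) := by
  have hk : (0 : ℝ) < (1 / 2) ^ k := by positivity
  have h0 := mul_nonneg hk.le (Real.ofDigits_nonneg fun i => s (i + k))
  have h1 := mul_le_mul_of_nonneg_left (Real.ofDigits_le_one fun i => s (i + k)) hk.le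
  have hs : Real.ofDigits s = prefixValue (streamPrefix s k) +
      (1 / 2) ^ k * Real.ofDigits fun i => s (i + k) := by
    simpa [prefixValue_streamPrefix] using Real.ofDigits_eq_sum_add_ofDigits s k
  rw [dyadicInterval, length_streamPrefix, hs]
  constructor <;> linarith

lemma ofDigits_bits {x : ℝ} (hx : x ∈ Set.Icc 0 1) : Real.ofDigits (bits x) = x := by
  unfold bits
  split_ifs with h
  · simpa [h] using Real.ofDigits_const_last_eq_one' (b := 2) one_lt_two
  · exact Real.ofDigits_digits one_lt_two ⟨hx.1, lt_of_le_of_ne hx.2 h⟩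

lemma mem_dyadicInterval_bits {x : ℝ} (hx : x ∈ Set.Icc 0 1) (k : ℕ) :
    x ∈ dyadicInterval (streamPrefix (bits x) k) := by
  simpa only [ofDigits_bits hx] using ofDigits_mem_dyadicInterval (bits x) k

lemma streamPrefix_bits_eq {x : ℝ} {u : List (Fin 2)}
    (hx : x ∈ Set.Ioo (prefixValue u) (prefixValue u + (1 / 2 : ℝ) ^ u.length)) :
    streamPrefix (bits x) u.length = u := by
  have hx01 : x ∈ Set.Icc 0 1 :=
    ⟨(prefixValue_nonneg u).trans hx.1.le, hx.2.le.trans (prefixValue_add_le_one u)⟩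
  obtain ⟨hle, hge⟩ := mem_dyadicInterval_bits hx01 u.length
  refine eq_of_prefixValue_lt (length_streamPrefix _ _) (hle.trans_lt hx.2) (hx.1.trans_le hge)

lemma measurable_bits (k : ℕ) : Measurable fun x : ℝ => bits x k := by
  have hbits : (fun x : ℝ => bits x k) =
      fun x => if x = 1 then (1 : Fin 2) else Fin.ofNat 2 ⌊x * 2 ^ (k + 1)⌋₊ := by
    funext x
    unfold bits
    split_ifs <;> simp [Real.digits]
  rw [hbits]
  refine Measurable.ite (measurableSet_singleton 1) measurable_const ?_
  exact (measurable_of_countable (Fin.ofNat 2)).comp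
    (Nat.measurable_floor.comp (measurable_id.mul_const _))

/-- The left end of the dyadic interval of length `2 ^ (-k)` around `x`. -/
noncomputable def dyadicFloor (k : ℕ) (x : ℝ) : ℝ := prefixValue (streamPrefix (bits x) k)

lemma measurable_dyadicFloor (k : ℕ) : Measurable (dyadicFloor k) := by
  unfold dyadicFloor
  simp_rw [prefixValue_streamPrefix, Real.ofDigitsTerm]
  refine Finset.measurable_sum _ fun i _ => Measurable.mul_const ?_ _
  exact (measurable_of_countable fun b : Fin 2 => ((b : ℕ) : ℝ)).comp (measurable_bits i)

lemma dyadicFloor_nonneg (k : ℕ) (x : ℝ) : 0 ≤ dyadicFloor k x := prefixValue_nonneg _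

lemma dyadicFloor_add_le_one (k : ℕ) (x : ℝ) : dyadicFloor k x + (1 / 2 : ℝ) ^ k ≤ 1 := by
  simpa [dyadicFloor] using prefixValue_add_le_one (streamPrefix (bits x) k)

/-! ### Runs of algorithms -/

variable {n : ℕ}

/-- The number of known bits. -/
def Knowledge.size (K : Knowledge n) : ℕ := ∑ i, ∑ c, (K i c).length

lemma size_knowledge_le_bitsRead (A : Algorithm n) (w : Input n) (t : ℕ) :
    ((knowledge A w t).size : ℝ≥0∞) ≤ bitsRead A w :=
  le_iSup (fun t => ((knowledge A w t).size : ℝ≥0∞)) t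

lemma knowledge_succ_of_output (A : Algorithm n) (w : Input n) (t : ℕ) {χ : Signs n}
    (h : A (knowledge A w t) = Action.output χ) : knowledge A w (t + 1) = knowledge A w t := by
  simp only [knowledge, h]

lemma length_knowledge_succ (A : Algorithm n) (w : Input n) (t : ℕ) {j : Fin n} {d : Fin 2}
    (h : A (knowledge A w t) = Action.read j d) (i : Fin n) (c : Fin 2) :
    (knowledge A w (t + 1) i c).length =
      (knowledge A w t i c).length + if i = j ∧ c = d then 1 else 0 := by
  simp only [knowledge, h]
  split_ifs <;> simp

lemma size_knowledge_succ (A : Algorithm n) (w : Input n) (t : ℕ) {j : Fin n} {d : Fin 2}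
    (h : A (knowledge A w t) = Action.read j d) :
    (knowledge A w (t + 1)).size = (knowledge A w t).size + 1 := by
  have hone : (∑ i : Fin n, ∑ c : Fin 2, if i = j ∧ c = d then 1 else 0) = 1 := by
    rw [Finset.sum_eq_single j, Finset.sum_eq_single d] <;> simp +contextual
  simp_rw [Knowledge.size, length_knowledge_succ A w t h, Finset.sum_add_distrib, hone]

lemma knowledge_eq_streamPrefix (A : Algorithm n) (w : Input n) (t : ℕ) (i : Fin n) (c : Fin 2) :
    knowledge A w t i c = streamPrefix (w i c) (knowledge A w t i c).length := by
  induction t with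
  | zero => rfl
  | succ t ih =>
    cases h : A (knowledge A w t) with
    | output χ => rwa [knowledge_succ_of_output A w t h]
    | read j d =>
      simp only [knowledge, h]
      split_ifs
      · rw [List.length_append, List.length_singleton, streamPrefix_succ, ← ih]
      · exact ih

lemma knowledge_eq_of_output (A : Algorithm n) (w : Input n) {t s : ℕ} {χ : Signs n}
    (h : A (knowledge A w t) = Action.output χ) (hs : t ≤ s) :
    knowledge A w s = knowledge A w t := by
  induction s, hs using Nat.le_induction with
  | base => rfl
  | succ s _ ih => rw [knowledge_succ_of_output A w s (ih ▸ h), ih]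

lemma Outputs.unique {A : Algorithm n} {w : Input n} {χ χ' : Signs n}
    (h : Outputs A w χ) (h' : Outputs A w χ') : χ = χ' := by
  obtain ⟨t, ht⟩ := h
  obtain ⟨s, hs⟩ := h'
  rw [← knowledge_eq_of_output A w ht (le_max_left t s)] at ht
  rw [← knowledge_eq_of_output A w hs (le_max_right t s)] at hs
  exact Action.output.inj (ht.symm.trans hs)

lemma monotone_length_knowledge (A : Algorithm n) (w : Input n) (i : Fin n) (c : Fin 2) :
    Monotone fun t => (knowledge A w t i c).length := by
  refine monotone_nat_of_le_succ fun t => ?_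
  cases h : A (knowledge A w t) with
  | output χ => rw [knowledge_succ_of_output A w t h]
  | read j d => rw [length_knowledge_succ A w t h]; exact Nat.le_add_right _ _

lemma knowledge_congr (A : Algorithm n) {w w' : Input n} {t : ℕ}
    (h : ∀ i c, streamPrefix (w' i c) (knowledge A w t i c).length = knowledge A w t i c)
    {s : ℕ} (hs : s ≤ t) : knowledge A w' s = knowledge A w s := by
  induction s with
  | zero => rfl
  | succ s ih =>
    specialize ih (Nat.le_of_succ_le hs)
    cases hA : A (knowledge A w s) with
    | output χ =>
      rw [knowledge_succ_of_output A w s hA, knowledge_succ_of_output A w' s (ih ▸ hA), ih]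
    | read j d =>
      funext i c
      have hlen : (knowledge A w' (s + 1) i c).length = (knowledge A w (s + 1) i c).length := by
        rw [length_knowledge_succ A w s hA, length_knowledge_succ A w' s (ih ▸ hA), ih]
      have hagree := h i c
      rw [knowledge_eq_streamPrefix A w t, length_streamPrefix, streamPrefix_eq_iff] at hagree
      rw [knowledge_eq_streamPrefix A w', knowledge_eq_streamPrefix A w, hlen, streamPrefix_eq_iff]
      exact fun k hk => hagree k (hk.trans_le (monotone_length_knowledge A w i c hs))

lemma exists_output_of_size_le (A : Algorithm n) (w : Input n) {B : ℕ}
    (h : ∀ t, (knowledge A w t).size ≤ B) : ∃ χ, Outputs A w χ := by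
  by_contra! hno
  have hsize : ∀ t, t ≤ (knowledge A w t).size := by
    intro t
    induction t with
    | zero => exact Nat.zero_le _
    | succ t ih =>
      cases hA : A (knowledge A w t) with
      | output χ => exact absurd ⟨t, hA⟩ (hno χ)
      | read j d => rw [size_knowledge_succ A w t hA]; lia
  exact absurd ((hsize (B + 1)).trans (h (B + 1))) (Nat.not_succ_le_self B)

lemma points_inputOf {P : Fin n → Fin 2 → ℝ} (hP : ∀ i c, P i c ∈ Set.Icc (0 : ℝ) 1) :
    (inputOf P).points = P :=
  funext₂ fun i c => ofDigits_bits (hP i c)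

lemma points_mem_knownCell (A : Algorithm n) (w : Input n) (t : ℕ) (i : Fin n) :
    w.points i ∈ knownCell (knowledge A w t) i := by
  intro c
  have hmem := ofDigits_mem_dyadicInterval (w i c) (knowledge A w t i c).length
  rwa [← knowledge_eq_streamPrefix] at hmem

/-! ### Flat and nearly flat triangles -/

/-- Twice the signed area of a triangle. -/
def signedArea (a b c : Fin 2 → ℝ) : ℝ :=
  (b 0 - a 0) * (c 1 - a 1) - (b 1 - a 1) * (c 0 - a 0)

lemma orientation_eq_sign (a b c : Fin 2 → ℝ) :
    orientation a b c = SignType.sign (signedArea a b c) := by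
  unfold orientation signedArea
  rw [Matrix.det_fin_three]
  simp only [Fin.isValue, Matrix.of_apply, Matrix.cons_val', Matrix.cons_val]
  ring_nf

lemma continuous_signedArea :
    Continuous fun T : (Fin 2 → ℝ) × (Fin 2 → ℝ) × (Fin 2 → ℝ) =>
      signedArea T.1 T.2.1 T.2.2 := by
  unfold signedArea
  fun_prop

lemma exists_smul_eq_of_det_eq_zero {v w : Fin 2 → ℝ} (hv : v ≠ 0)
    (h : v 0 * w 1 - v 1 * w 0 = 0) : ∃ t : ℝ, t • v = w := by
  have hpos : v 0 ^ 2 + v 1 ^ 2 ≠ 0 := by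
    contrapose! hv
    ext i
    fin_cases i <;> simp only [Pi.zero_apply, Fin.zero_eta, Fin.mk_one, Fin.isValue] <;> nlinarith
  refine ⟨(v 0 * w 0 + v 1 * w 1) / (v 0 ^ 2 + v 1 ^ 2), funext fun i => ?_⟩
  rw [Pi.smul_apply, smul_eq_mul, div_mul_eq_mul_div, div_eq_iff hpos]
  fin_cases i <;> simp only [Fin.zero_eta, Fin.mk_one, Fin.isValue]
  · linear_combination v 1 * h
  · linear_combination -v 0 * h

lemma signedArea_eq_zero_iff {a b c : Fin 2 → ℝ} :
    signedArea a b c = 0 ↔ ∃ x v : Fin 2 → ℝ, v ≠ 0 ∧ (∃ t : ℝ, x + t • v = a) ∧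
      (∃ t : ℝ, x + t • v = b) ∧ (∃ t : ℝ, x + t • v = c) := by
  constructor
  · intro h
    by_cases hab : b = a
    · by_cases hac : c = a
      · exact ⟨a, 1, one_ne_zero, ⟨0, by simp⟩, ⟨0, by simp [hab]⟩, ⟨0, by simp [hac]⟩⟩
      · exact ⟨a, c - a, sub_ne_zero.2 hac, ⟨0, by simp⟩, ⟨0, by simp [hab]⟩, ⟨1, by simp⟩⟩
    · obtain ⟨t, ht⟩ := exists_smul_eq_of_det_eq_zero (sub_ne_zero.2 hab) (w := c - a) h
      exact ⟨a, b - a, sub_ne_zero.2 hab, ⟨0, by simp⟩, ⟨1, by simp⟩, ⟨t, by simp [ht]⟩⟩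
  · rintro ⟨x, v, -, ⟨t, rfl⟩, ⟨s, rfl⟩, ⟨u, rfl⟩⟩
    simp only [signedArea, Pi.add_apply, Pi.smul_apply, smul_eq_mul]
    ring

/-- The three points are `ε`-close (in the sup norm) to three aligned points. -/
def NearLine (ε : ℝ) (a b c : Fin 2 → ℝ) : Prop :=
  ∃ a' b' c', signedArea a' b' c' = 0 ∧ dist a a' ≤ ε ∧ dist b b' ≤ ε ∧ dist c c' ≤ ε

lemma eventually_not_nearLine {a b c : Fin 2 → ℝ} (h : signedArea a b c ≠ 0) :
    ∀ᶠ ε in nhds 0, ¬ NearLine ε a b c := by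
  have hnhds := (continuous_signedArea.continuousAt (x := (a, b, c))).eventually_ne h
  obtain ⟨δ, hδ, hball⟩ := Metric.nhds_basis_closedBall.eventually_iff.1 hnhds
  filter_upwards [eventually_le_nhds hδ] with ε hε ⟨a', b', c', hflat, ha, hb, hc⟩
  refine hball (x := (a', b', c')) ?_ hflat
  simp only [Metric.mem_closedBall, Prod.dist_eq, max_le_iff]
  rw [dist_comm a', dist_comm b', dist_comm c']
  exact ⟨ha.trans hε, hb.trans hε, hc.trans hε⟩

/-- The value at abscissa `c d` of the affine function through `a` and `b`, where `d` is the
axis of abscissas and `1 - d` that of ordinates. -/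
noncomputable def interpolate (d : Fin 2) (a b c : Fin 2 → ℝ) : ℝ :=
  a (1 - d) + (c d - a d) / (b d - a d) * (b (1 - d) - a (1 - d))

/-- Taking as axis of abscissas one along which the line is steepest makes its slope at most `1`,
whence the factor `2`. -/
lemma NearLine.exists_affine {ε : ℝ} {a b c : Fin 2 → ℝ} (h : NearLine ε a b c) :
    ∃ (d : Fin 2) (α β : ℝ), |a (1 - d) - (α * a d + β)| ≤ 2 * ε ∧
      |b (1 - d) - (α * b d + β)| ≤ 2 * ε ∧ |c (1 - d) - (α * c d + β)| ≤ 2 * ε := by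
  obtain ⟨a', b', c', hflat, ha, hb, hc⟩ := h
  obtain ⟨x, v, hv, hta, htb, htc⟩ := signedArea_eq_zero_iff.1 hflat
  obtain ⟨d, hd⟩ : ∃ d : Fin 2, |v (1 - d)| ≤ |v d| := by
    rcases le_total |v 0| |v 1| with h | h
    · exact ⟨1, by simpa using h⟩
    · exact ⟨0, by simpa using h⟩
  have hvd : v d ≠ 0 := by
    intro h0
    have h1 : v (1 - d) = 0 := by simpa [h0] using hd
    refine hv (funext fun i => ?_)
    fin_cases d <;> fin_cases i <;> simp_all
  have hslope : |v (1 - d) / v d| ≤ 1 := by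
    rw [abs_div]
    exact div_le_one_of_le₀ hd (abs_nonneg _)
  have hclose : ∀ p p' : Fin 2 → ℝ, (∃ t : ℝ, x + t • v = p') → dist p p' ≤ ε →
      |p (1 - d) - (v (1 - d) / v d * p d + (x (1 - d) - v (1 - d) / v d * x d))| ≤ 2 * ε := by
    rintro p _ ⟨t, rfl⟩ hp
    have hcoord (i : Fin 2) : |p i - (x i + t * v i)| ≤ ε := (dist_le_pi_dist p _ i).trans hp
    have hsplit : p (1 - d) - (v (1 - d) / v d * p d + (x (1 - d) - v (1 - d) / v d * x d)) =
        (p (1 - d) - (x (1 - d) + t * v (1 - d))) -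
          v (1 - d) / v d * (p d - (x d + t * v d)) := by
      field_simp
      ring
    rw [hsplit, two_mul]
    refine (abs_sub _ _).trans (add_le_add (hcoord _) ?_)
    rw [abs_mul]
    exact (mul_le_of_le_one_left (abs_nonneg _) hslope).trans (hcoord d)
  exact ⟨d, _, _, hclose a a' hta ha, hclose b b' htb hb, hclose c c' htc hc⟩

lemma abs_sub_interpolate_le {ε α β : ℝ} {d : Fin 2} {a b c : Fin 2 → ℝ}
    (ha : |a (1 - d) - (α * a d + β)| ≤ ε) (hb : |b (1 - d) - (α * b d + β)| ≤ ε)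
    (hc : |c (1 - d) - (α * c d + β)| ≤ ε) (h : c d ∈ Set.uIcc (a d) (b d)) :
    |c (1 - d) - interpolate d a b c| ≤ 2 * ε := by
  obtain ⟨hτ, hτ0, hτ1⟩ : (c d - a d) / (b d - a d) * (b d - a d) = c d - a d ∧
      0 ≤ (c d - a d) / (b d - a d) ∧ (c d - a d) / (b d - a d) ≤ 1 := by
    rcases eq_or_ne (a d) (b d) with hab | hab
    · have hca : c d = a d := by simpa [← hab] using h
      simp [hca]
    · refine ⟨div_mul_cancel₀ _ (sub_ne_zero.2 hab.symm), ?_⟩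
      rcases Set.mem_uIcc.1 h with h | h
      · exact ⟨div_nonneg (by linarith) (by linarith),
          div_le_one_of_le₀ (by linarith) (by linarith)⟩
      · exact ⟨div_nonneg_of_nonpos (by linarith) (by linarith),
          div_le_one_of_ge (by linarith) (by linarith)⟩
  unfold interpolate
  generalize (c d - a d) / (b d - a d) = τ at hτ hτ0 hτ1 ⊢
  have hsplit : c (1 - d) - (a (1 - d) + τ * (b (1 - d) - a (1 - d))) =
      (c (1 - d) - (α * c d + β)) - ((1 - τ) * (a (1 - d) - (α * a d + β)) +
        τ * (b (1 - d) - (α * b d + β))) := by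
    linear_combination -α * hτ
  have hcombo : |(1 - τ) * (a (1 - d) - (α * a d + β)) + τ * (b (1 - d) - (α * b d + β))| ≤ ε := by
    rw [abs_le] at ha hb ⊢
    constructor <;> nlinarith
  rw [hsplit, two_mul]
  exact (abs_sub _ _).trans (add_le_add hc hcombo)

lemma NearLine.exists_interpolate {ε : ℝ} {a b c : Fin 2 → ℝ} (h : NearLine ε a b c) :
    ∃ d : Fin 2, |c (1 - d) - interpolate d a b c| ≤ 4 * ε ∨
      |b (1 - d) - interpolate d a c b| ≤ 4 * ε ∨ |a (1 - d) - interpolate d b c a| ≤ 4 * ε := by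
  obtain ⟨d, α, β, ha, hb, hc⟩ := h.exists_affine
  have hmedian : c d ∈ Set.uIcc (a d) (b d) ∨ b d ∈ Set.uIcc (a d) (c d) ∨
      a d ∈ Set.uIcc (b d) (c d) := by
    generalize a d = x, b d = y, c d = z
    clear ha hb hc h
    simp only [Set.mem_uIcc]
    grind
  rw [show 4 * ε = 2 * (2 * ε) by ring]
  exact ⟨d, hmedian.imp (abs_sub_interpolate_le ha hb hc)
    (Or.imp (abs_sub_interpolate_le ha hc hb) (abs_sub_interpolate_le hb hc ha))⟩

/-! ### Runs of the greedy method -/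

lemma unresolved_iff_exists_signedArea_eq_zero {K : Knowledge n} {a b c : Fin n} :
    Unresolved K a b c ↔ a ≠ b ∧ b ≠ c ∧ a ≠ c ∧
      ∃ p ∈ knownCell K a, ∃ q ∈ knownCell K b, ∃ r ∈ knownCell K c, signedArea p q r = 0 := by
  simp only [Unresolved, signedArea_eq_zero_iff]
  refine and_congr_right' (and_congr_right' (and_congr_right' ⟨?_, ?_⟩))
  · rintro ⟨x, v, hv, ⟨t, ht⟩, ⟨s, hs⟩, ⟨u, hu⟩⟩
    exact ⟨_, ht, _, hs, _, hu, x, v, hv, ⟨t, rfl⟩, ⟨s, rfl⟩, ⟨u, rfl⟩⟩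
  · rintro ⟨_, hp, _, hq, _, hr, x, v, hv, ⟨t, rfl⟩, ⟨s, rfl⟩, ⟨u, rfl⟩⟩
    exact ⟨x, v, hv, ⟨t, hp⟩, ⟨s, hq⟩, ⟨u, hr⟩⟩

lemma dist_le_of_mem_knownCell {K : Knowledge n} {i : Fin n} {k : ℕ}
    (hk : ∀ c, k ≤ (K i c).length) {p q : Fin 2 → ℝ} (hp : p ∈ knownCell K i)
    (hq : q ∈ knownCell K i) : dist p q ≤ (1 / 2) ^ k := by
  refine (dist_pi_le_iff (by positivity)).2 fun c => ?_
  refine (Real.dist_le_of_mem_Icc (hp c) (hq c)).trans ?_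
  rw [add_sub_cancel_left]
  exact pow_le_pow_of_le_one (by norm_num) (by norm_num) (hk c)

lemma Unresolved.nearLine {K : Knowledge n} (hK : Balanced K) {a b c : Fin n}
    (h : Unresolved K a b c) (hab : (K a 0).length ≤ (K b 0).length)
    (hac : (K a 0).length ≤ (K c 0).length) {P : Fin n → Fin 2 → ℝ}
    (hP : ∀ i, P i ∈ knownCell K i) : NearLine ((1 / 2) ^ (K a 0).length) (P a) (P b) (P c) := by
  obtain ⟨-, -, -, p, hp, q, hq, r, hr, hflat⟩ := unresolved_iff_exists_signedArea_eq_zero.1 h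
  have hdist (j : Fin n) (hj : (K a 0).length ≤ (K j 0).length) {x : Fin 2 → ℝ}
      (hx : x ∈ knownCell K j) : dist (P j) x ≤ (1 / 2) ^ (K a 0).length :=
    dist_le_of_mem_knownCell (Fin.forall_fin_two.2 ⟨hj, hK j ▸ hj⟩) (hP j) hx
  exact ⟨p, q, r, hflat, hdist a le_rfl hp, hdist b hab hq, hdist c hac hr⟩

/-- The `i`-th point and some two others are `ε`-close to three aligned points. With `ε = 2 ^ (-r)`
this is what makes the greedy method refine the point `i` beyond its `r` first bits. -/
def NearLineAt (ε : ℝ) (P : Fin n → Fin 2 → ℝ) (i : Fin n) : Prop :=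
  ∃ b c, i ≠ b ∧ b ≠ c ∧ i ≠ c ∧ NearLine ε (P i) (P b) (P c)

/-- The known bits are balanced, or become so once one bit of some second coordinate is read. The
greedy method only meets such knowledge. -/
def AlmostBalanced (K : Knowledge n) : Prop :=
  Balanced K ∨ ∃ i, (K i 0).length = (K i 1).length + 1 ∧
    ∀ j, j ≠ i → (K j 0).length = (K j 1).length

lemma AlmostBalanced.length_le {K : Knowledge n} (hK : AlmostBalanced K) (i : Fin n) (c : Fin 2) :
    (K i c).length ≤ (K i 0).length := by
  revert c
  rw [Fin.forall_fin_two]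
  refine ⟨le_rfl, ?_⟩
  obtain hK | ⟨j, hj, hne⟩ := hK
  · exact (hK i).ge
  · rcases eq_or_ne i j with rfl | hij
    · exact (Nat.le_succ _).trans hj.ge
    · exact (hne i hij).ge

lemma IsGreedy.almostBalanced {A : Algorithm n} (hA : IsGreedy A) (w : Input n) (t : ℕ) :
    AlmostBalanced (knowledge A w t) := by
  induction t with
  | zero => exact Or.inl fun _ => rfl
  | succ t ih =>
    obtain hb | ⟨i, hi, hne⟩ := ih
    · by_cases hu : ∃ a b c, Unresolved (knowledge A w t) a b c
      · obtain ⟨a, -, -, -, -, -, hread⟩ := hA.select _ hb hu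
        refine Or.inr ⟨a, ?_, fun j hj => ?_⟩
        · simp [length_knowledge_succ A w t hread, hb a]
        · simp [length_knowledge_succ A w t hread, hb j, hj]
      · obtain ⟨χ, hχ, -⟩ := hA.finish _ hb hu
        rw [knowledge_succ_of_output A w t hχ]
        exact Or.inl hb
    · refine Or.inl fun j => ?_
      rw [length_knowledge_succ A w t (hA.second _ i hi hne),
        length_knowledge_succ A w t (hA.second _ i hi hne)]
      rcases eq_or_ne j i with rfl | hji
      · simp [hi]
      · simp [hji, hne j hji]

lemma IsGreedy.nearLineAt_of_lt_length {A : Algorithm n} (hA : IsGreedy A) (w : Input n) {t : ℕ}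
    {i : Fin n} {r : ℕ} (hr : r < (knowledge A w t i 0).length) :
    NearLineAt ((1 / 2) ^ r) w.points i := by
  induction t with
  | zero => exact absurd hr (Nat.not_lt_zero r)
  | succ t ih =>
    obtain hb | ⟨j, hj, hne⟩ := hA.almostBalanced w t
    · by_cases hu : ∃ a b c, Unresolved (knowledge A w t) a b c
      · obtain ⟨a, b, c, hu, hab, hac, hread⟩ := hA.select _ hb hu
        by_cases hlt : r < (knowledge A w t i 0).length
        · exact ih hlt
        obtain ⟨rfl, rfl⟩ : i = a ∧ r = (knowledge A w t i 0).length := by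
          rw [length_knowledge_succ A w t hread] at hr
          grind
        exact ⟨b, c, hu.1, hu.2.1, hu.2.2.1, hu.nearLine hb hab hac (points_mem_knownCell A w t)⟩
      · obtain ⟨χ, hχ, -⟩ := hA.finish _ hb hu
        exact ih (knowledge_succ_of_output A w t hχ ▸ hr)
    · exact ih (by simpa [length_knowledge_succ A w t (hA.second _ j hj hne)] using hr)

lemma IsGreedy.bitsRead_le {A : Algorithm n} (hA : IsGreedy A) (w : Input n) :
    bitsRead A w ≤ 2 * ∑' x : Fin n × ℕ,
      {P | NearLineAt ((1 / 2) ^ x.2) P x.1}.indicator 1 w.points := by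
  refine iSup_le fun t => ?_
  rw [ENNReal.tsum_prod', tsum_fintype, Finset.mul_sum]
  push_cast
  refine Finset.sum_le_sum fun i _ => ?_
  have hfst : ((knowledge A w t i 0).length : ℝ≥0∞) ≤
      ∑' r : ℕ, {P | NearLineAt ((1 / 2) ^ r) P i}.indicator 1 w.points := by
    calc ((knowledge A w t i 0).length : ℝ≥0∞)
        = ∑ r ∈ Finset.range (knowledge A w t i 0).length, 1 := by simp
      _ = ∑ r ∈ Finset.range (knowledge A w t i 0).length,
            {P | NearLineAt ((1 / 2) ^ r) P i}.indicator 1 w.points :=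
          Finset.sum_congr rfl fun r hr => by
            rw [Set.indicator_of_mem, Pi.one_apply]
            exact hA.nearLineAt_of_lt_length w (Finset.mem_range.1 hr)
      _ ≤ _ := ENNReal.sum_le_tsum _
  rw [Fin.sum_univ_two, two_mul]
  exact add_le_add hfst
    ((Nat.cast_le.2 ((hA.almostBalanced w t).length_le i 1)).trans hfst)

lemma IsGreedy.eq_chirotope_of_outputs {A : Algorithm n} (hA : IsGreedy A) {w : Input n}
    {χ : Signs n} (h : Outputs A w χ) : χ = chirotope w.points := by
  obtain ⟨t, ht⟩ := h
  obtain hb | ⟨i, hi, hne⟩ := hA.almostBalanced w t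
  · by_cases hu : ∃ a b c, Unresolved (knowledge A w t) a b c
    · obtain ⟨a, b, c, -, -, -, hread⟩ := hA.select _ hb hu
      simp [ht] at hread
    · obtain ⟨χ', hχ', hall⟩ := hA.finish _ hb hu
      rw [hall _ (points_mem_knownCell A w t)]
      exact Action.output.inj (ht.symm.trans hχ')
  · simpa [ht] using hA.second _ i hi hne

lemma exists_forall_not_nearLineAt {P : Fin n → Fin 2 → ℝ} (hP : InGeneralPosition P) :
    ∃ r : ℕ, ∀ i, ¬ NearLineAt ((1 / 2) ^ r) P i := by
  have htend : Filter.Tendsto (fun r : ℕ => (1 / 2 : ℝ) ^ r) Filter.atTop (nhds 0) :=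
    tendsto_pow_atTop_nhds_zero_of_lt_one (by norm_num) (by norm_num)
  suffices h : ∀ᶠ r : ℕ in Filter.atTop, ∀ i b c, i ≠ b → b ≠ c → i ≠ c →
      ¬ NearLine ((1 / 2) ^ r) (P i) (P b) (P c) by
    obtain ⟨r, hr⟩ := h.exists
    exact ⟨r, fun i ⟨b, c, hib, hbc, hic, hnear⟩ => hr i b c hib hbc hic hnear⟩
  simp only [Filter.eventually_all]
  intro i b c hib hbc hic
  refine htend.eventually (eventually_not_nearLine ?_)
  have hχ := hP i b c hib hbc hic
  rwa [chirotope, orientation_eq_sign, sign_ne_zero] at hχ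

lemma IsGreedy.outputs_of_inGeneralPosition {A : Algorithm n} (hA : IsGreedy A) (w : Input n)
    (hw : InGeneralPosition w.points) : Outputs A w (chirotope w.points) := by
  obtain ⟨R, hR⟩ := exists_forall_not_nearLineAt hw
  have hlen (t : ℕ) (i : Fin n) (c : Fin 2) : (knowledge A w t i c).length ≤ R :=
    ((hA.almostBalanced w t).length_le i c).trans <| not_lt.1 fun hlt =>
      hR i (hA.nearLineAt_of_lt_length w hlt)
  obtain ⟨χ, hχ⟩ := exists_output_of_size_le A w (B := ∑ _i : Fin n, ∑ _c : Fin 2, R)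
    fun t => Finset.sum_le_sum fun i _ => Finset.sum_le_sum fun c _ => hlen t i c
  exact hA.eq_chirotope_of_outputs hχ ▸ hχ

/-! ### Integration over one coordinate of a uniform sample -/

lemma uniformSquare_eq_pi :
    uniformSquare = Measure.pi fun _ : Fin 2 => (volume : Measure ℝ).restrict (Set.Icc 0 1) := by
  unfold uniformSquare
  rw [volume_pi, ← Measure.restrict_pi_pi, Set.pi_univ_Icc]
  rfl

instance : IsProbabilityMeasure ((volume : Measure ℝ).restrict (Set.Icc 0 1)) := ⟨by simp⟩

instance : IsProbabilityMeasure uniformSquare := by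
  rw [uniformSquare_eq_pi]; infer_instance

instance : IsProbabilityMeasure (uniformSample n) := by
  unfold uniformSample; infer_instance

lemma ae_mem_Icc : ∀ᵐ P ∂(uniformSample n), ∀ i c, P i c ∈ Set.Icc (0 : ℝ) 1 := by
  have hsquare : ∀ᵐ p ∂uniformSquare, ∀ c, p c ∈ Set.Icc (0 : ℝ) 1 :=
    (ae_restrict_mem measurableSet_Icc).mono fun p hp c => ⟨hp.1 c, hp.2 c⟩
  exact ae_all_iff.2 fun i =>
    (Measure.quasiMeasurePreserving_eval (μ := fun _ => uniformSquare) i).ae hsquare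

lemma lintegral_pi_eq_lintegral_update {ι : Type*} [Fintype ι] [DecidableEq ι] {X : ι → Type*}
    [∀ i, MeasurableSpace (X i)] (μ : ∀ i, Measure (X i)) [∀ i, IsProbabilityMeasure (μ i)] (i : ι)
    {f : (∀ i, X i) → ℝ≥0∞} (hf : Measurable f) :
    ∫⁻ x, f x ∂(Measure.pi μ) = ∫⁻ x, ∫⁻ y, f (Function.update x i y) ∂(μ i) ∂(Measure.pi μ) := by
  have hg : Measurable fun x => ∫⁻ y, f (Function.update x i y) ∂(μ i) :=
    (hf.comp measurable_update').lintegral_prod_right'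
  refine lintegral_eq_of_lmarginal_eq {i} hf hg ?_
  simp [lmarginal_singleton]

/-- The sample obtained from `P` by setting coordinate `d` of the point `c` to `z`. -/
def setCoord (P : Fin n → Fin 2 → ℝ) (c : Fin n) (d : Fin 2) (z : ℝ) : Fin n → Fin 2 → ℝ :=
  Function.update P c (Function.update (P c) d z)

@[simp] lemma setCoord_self (P : Fin n → Fin 2 → ℝ) (c : Fin n) (d : Fin 2) (z : ℝ) :
    setCoord P c d z c d = z := by simp [setCoord]

lemma setCoord_of_ne (P : Fin n → Fin 2 → ℝ) {c a : Fin n} (d : Fin 2) (z : ℝ) (h : a ≠ c) :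
    setCoord P c d z a = P a := by simp [setCoord, h]

lemma setCoord_of_ne_axis (P : Fin n → Fin 2 → ℝ) (c : Fin n) {d e : Fin 2} (z : ℝ) (h : e ≠ d) :
    setCoord P c d z c e = P c e := by simp [setCoord, h]

lemma one_sub_ne_self (d : Fin 2) : 1 - d ≠ d := by fin_cases d <;> decide

lemma measurable_setCoord (c : Fin n) (d : Fin 2) :
    Measurable fun x : (Fin n → Fin 2 → ℝ) × ℝ => setCoord x.1 c d x.2 :=
  (measurable_update' (X := fun _ => Fin 2 → ℝ)).comp (measurable_fst.prodMk
    ((measurable_update' (X := fun _ => ℝ)).comp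
      (((measurable_pi_apply c).comp measurable_fst).prodMk measurable_snd)))

lemma measurableSet_setCoord {S : Set (Fin n → Fin 2 → ℝ)} (hS : MeasurableSet S) (c : Fin n)
    (d : Fin 2) (P : Fin n → Fin 2 → ℝ) : MeasurableSet {z | setCoord P c d z ∈ S} :=
  ((measurable_setCoord c d).comp measurable_prodMk_left) hS

lemma lintegral_uniformSample_eq_lintegral_setCoord (c : Fin n) (d : Fin 2)
    {f : (Fin n → Fin 2 → ℝ) → ℝ≥0∞} (hf : Measurable f) :
    ∫⁻ P, f P ∂(uniformSample n) =
      ∫⁻ P, (∫⁻ z in Set.Icc 0 1, f (setCoord P c d z)) ∂(uniformSample n) := by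
  have hg : Measurable fun P => ∫⁻ z in Set.Icc 0 1, f (setCoord P c d z) :=
    (hf.comp (measurable_setCoord c d)).lintegral_prod_right'
  have hsquare (P : Fin n → Fin 2 → ℝ) : ∫⁻ p, f (Function.update P c p) ∂uniformSquare =
      ∫⁻ p, (∫⁻ z in Set.Icc 0 1, f (Function.update P c (Function.update p d z)))
        ∂uniformSquare := by
    rw [uniformSquare_eq_pi]
    exact lintegral_pi_eq_lintegral_update _ d (hf.comp (measurable_update P))
  unfold uniformSample
  rw [lintegral_pi_eq_lintegral_update _ c hf, lintegral_pi_eq_lintegral_update _ c hg]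
  simp only [hsquare, setCoord, Function.update_self, Function.update_idem]

lemma uniformSample_eq_lintegral_setCoord (c : Fin n) (d : Fin 2) {S : Set (Fin n → Fin 2 → ℝ)}
    (hS : MeasurableSet S) : uniformSample n S =
      ∫⁻ P, volume ({z | setCoord P c d z ∈ S} ∩ Set.Icc 0 1) ∂(uniformSample n) := by
  rw [← lintegral_indicator_one hS,
    lintegral_uniformSample_eq_lintegral_setCoord c d (measurable_one.indicator hS)]
  refine lintegral_congr fun P => ?_
  rw [← Measure.restrict_apply (measurableSet_setCoord hS c d P),
    ← lintegral_indicator_one (measurableSet_setCoord hS c d P)]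
  rfl

lemma measure_le_mul_of_setCoord (c : Fin n) (d : Fin 2) {S T : Set (Fin n → Fin 2 → ℝ)}
    (hS : MeasurableSet S) (hT : MeasurableSet T) {B : ℝ≥0∞}
    (hST : ∀ P z, setCoord P c d z ∈ S → P ∈ T)
    (h : ∀ P ∈ T, volume {z | setCoord P c d z ∈ S} ≤ B) :
    uniformSample n S ≤ B * uniformSample n T := by
  rw [uniformSample_eq_lintegral_setCoord c d hS, ← lintegral_indicator_const hT]
  refine lintegral_mono fun P => ?_
  by_cases hP : P ∈ T
  · rw [Set.indicator_of_mem hP]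
    exact (measure_mono Set.inter_subset_left).trans (h P hP)
  · have hempty : {z | setCoord P c d z ∈ S} = ∅ :=
      Set.eq_empty_of_forall_notMem fun z hz => hP (hST P z hz)
    simp [hempty]

lemma measure_le_of_setCoord (c : Fin n) (d : Fin 2) {S : Set (Fin n → Fin 2 → ℝ)}
    (hS : MeasurableSet S) {B : ℝ≥0∞} (h : ∀ P, volume {z | setCoord P c d z ∈ S} ≤ B) :
    uniformSample n S ≤ B := by
  simpa using measure_le_mul_of_setCoord c d hS MeasurableSet.univ (fun P _ _ => Set.mem_univ P)
    fun P _ => h P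

lemma mul_measure_le_of_setCoord (c : Fin n) (d : Fin 2) {S T : Set (Fin n → Fin 2 → ℝ)}
    (hS : MeasurableSet S) (hT : MeasurableSet T) {B : ℝ≥0∞}
    (h : ∀ P ∈ T, B ≤ volume ({z | setCoord P c d z ∈ S} ∩ Set.Icc 0 1)) :
    B * uniformSample n T ≤ uniformSample n S := by
  rw [uniformSample_eq_lintegral_setCoord c d hS, ← lintegral_indicator_const hT]
  exact lintegral_mono (Set.indicator_le h)

/-! ### The average cost of the greedy method -/

lemma measurable_coord (a : Fin n) (d : Fin 2) :
    Measurable fun P : Fin n → Fin 2 → ℝ => P a d :=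
  (measurable_pi_apply d).comp (measurable_pi_apply a)

lemma measurable_interpolate (d : Fin 2) (a b c : Fin n) :
    Measurable fun P : Fin n → Fin 2 → ℝ => interpolate d (P a) (P b) (P c) := by
  unfold interpolate
  have h (a : Fin n) := measurable_coord a
  exact (h a _).add ((((h c _).sub (h a _)).div ((h b _).sub (h a _))).mul ((h b _).sub (h a _)))

lemma measure_abs_sub_interpolate_le (δ : ℝ) (d : Fin 2) {a b c : Fin n} (hac : a ≠ c)
    (hbc : b ≠ c) :
    uniformSample n {P | |P c (1 - d) - interpolate d (P a) (P b) (P c)| ≤ δ} ≤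
      ENNReal.ofReal (2 * δ) := by
  refine measure_le_of_setCoord c (1 - d) (measurableSet_le ((measurable_coord c _).sub
    (measurable_interpolate d a b c)).abs measurable_const) fun P => ?_
  refine le_of_eq ?_
  calc volume {z | setCoord P c (1 - d) z ∈
        {P | |P c (1 - d) - interpolate d (P a) (P b) (P c)| ≤ δ}}
      = volume (Metric.closedBall (interpolate d (P a) (P b) (P c)) δ) := by
        congr with z
        simp [interpolate, setCoord_of_ne P _ z hac, setCoord_of_ne P _ z hbc,
          setCoord_of_ne_axis P c z (one_sub_ne_self d).symm, Real.dist_eq]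
    _ = ENNReal.ofReal (2 * δ) := Real.volume_closedBall _ _

lemma measure_nearLine_le {ε : ℝ} (hε : 0 ≤ ε) {a b c : Fin n} (hab : a ≠ b) (hbc : b ≠ c)
    (hac : a ≠ c) :
    uniformSample n {P | NearLine ε (P a) (P b) (P c)} ≤ ENNReal.ofReal (48 * ε) := by
  have hsub : {P : Fin n → Fin 2 → ℝ | NearLine ε (P a) (P b) (P c)} ⊆ ⋃ d : Fin 2,
      {P | |P c (1 - d) - interpolate d (P a) (P b) (P c)| ≤ 4 * ε} ∪
      ({P | |P b (1 - d) - interpolate d (P a) (P c) (P b)| ≤ 4 * ε} ∪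
        {P | |P a (1 - d) - interpolate d (P b) (P c) (P a)| ≤ 4 * ε}) :=
    fun P hP => Set.mem_iUnion.2 hP.exists_interpolate
  calc uniformSample n {P | NearLine ε (P a) (P b) (P c)}
      ≤ ∑ _d : Fin 2, (ENNReal.ofReal (2 * (4 * ε)) + (ENNReal.ofReal (2 * (4 * ε)) +
          ENNReal.ofReal (2 * (4 * ε)))) := by
        refine (measure_mono hsub).trans ((measure_iUnion_fintype_le _ _).trans ?_)
        gcongr with d
        refine (measure_union_le _ _).trans (add_le_add ?_ ((measure_union_le _ _).trans ?_))
        · exact measure_abs_sub_interpolate_le _ d hac hbc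
        · exact add_le_add (measure_abs_sub_interpolate_le _ d hab hbc.symm)
            (measure_abs_sub_interpolate_le _ d hab.symm hac.symm)
    _ = ENNReal.ofReal (48 * ε) := by
        rw [Fin.sum_univ_two, ← ENNReal.ofReal_add (by positivity) (by positivity),
          ← ENNReal.ofReal_add (by positivity) (by positivity),
          ← ENNReal.ofReal_add (by positivity) (by positivity)]
        ring_nf

lemma measure_nearLineAt_le {ε : ℝ} (hε : 0 ≤ ε) (i : Fin n) :
    uniformSample n {P | NearLineAt ε P i} ≤ ENNReal.ofReal (48 * n ^ 2 * ε) := by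
  have hsub : {P | NearLineAt ε P i} ⊆ ⋃ (b : Fin n) (c : Fin n) (_ : i ≠ b ∧ b ≠ c ∧ i ≠ c),
      {P | NearLine ε (P i) (P b) (P c)} := by
    rintro P ⟨b, c, hib, hbc, hic, hP⟩
    simp only [Set.mem_iUnion]
    exact ⟨b, c, ⟨hib, hbc, hic⟩, hP⟩
  calc uniformSample n {P | NearLineAt ε P i}
      ≤ ∑ _b : Fin n, ∑ _c : Fin n, ENNReal.ofReal (48 * ε) := by
        refine (measure_mono hsub).trans ((measure_iUnion_fintype_le _ _).trans ?_)
        gcongr with b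
        refine (measure_iUnion_fintype_le _ _).trans ?_
        gcongr with c
        by_cases h : i ≠ b ∧ b ≠ c ∧ i ≠ c
        · simpa [h] using measure_nearLine_le hε h.1 h.2.1 h.2.2
        · simp [h]
    _ = ENNReal.ofReal (48 * n ^ 2 * ε) := by
        simp only [Finset.sum_const, Finset.card_univ, Fintype.card_fin, nsmul_eq_mul]
        rw [← ENNReal.ofReal_natCast, ← ENNReal.ofReal_mul (by positivity),
          ← ENNReal.ofReal_mul (by positivity)]
        ring_nf

lemma ae_inGeneralPosition : ∀ᵐ P ∂(uniformSample n), InGeneralPosition P := by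
  have hnear (i : Fin n) : ∀ᵐ P ∂(uniformSample n), ¬ NearLineAt 0 P i := by
    have hzero := measure_nearLineAt_le le_rfl i
    rw [mul_zero, ENNReal.ofReal_zero, nonpos_iff_eq_zero] at hzero
    exact measure_eq_zero_iff_ae_notMem.1 hzero
  filter_upwards [ae_all_iff.2 hnear] with P hP i j k hij hjk hik hχ
  rw [chirotope, orientation_eq_sign, sign_eq_zero_iff] at hχ
  exact hP i ⟨j, k, hij, hjk, hik, P i, P j, P k, hχ, by simp, by simp, by simp⟩

theorem IsGreedy.determinesChirotope {A : Algorithm n} (hA : IsGreedy A) :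
    DeterminesChirotope A := by
  unfold DeterminesChirotope
  filter_upwards [ae_mem_Icc, ae_inGeneralPosition] with P hP hgp
  simpa only [points_inputOf hP] using
    hA.outputs_of_inGeneralPosition (inputOf P) (by rwa [points_inputOf hP])

lemma half_rpow_le {x : ℝ} (h0 : 0 ≤ x) (h1 : x ≤ 1) : (1 / 2 : ℝ) ^ x ≤ 1 - x / 2 := by
  have h := rpow_one_add_le_one_add_mul_self (s := -1 / 2) (by norm_num) h0 h1
  norm_num at h ⊢
  linarith

lemma tsum_ofReal_mul_half_pow {B : ℝ} (hB : 0 ≤ B) :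
    ∑' r : ℕ, ENNReal.ofReal (B * (1 / 2) ^ r) = ENNReal.ofReal (2 * B) := by
  rw [← ENNReal.ofReal_tsum_of_nonneg (fun r => by positivity) (summable_geometric_two.mul_left B),
    tsum_mul_left, tsum_geometric_two, mul_comm]

lemma tsum_min_one_geometric_le {L : ℝ} (hL : 0 ≤ L) :
    ∑' r : ℕ, min 1 (ENNReal.ofReal (2 ^ L * (1 / 2) ^ r)) ≤ ENNReal.ofReal (L + 2) := by
  obtain ⟨k, hk, hk'⟩ : ∃ k : ℕ, L ≤ k ∧ (k : ℝ) ≤ L + 1 :=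
    ⟨⌈L⌉₊, Nat.le_ceil L, (Nat.ceil_lt_add_one hL).le⟩
  have hpow : (2 : ℝ) ^ L * (1 / 2) ^ k ≤ 1 - (k - L) / 2 := by
    refine le_trans (le_of_eq ?_) (half_rpow_le (by linarith) (by linarith))
    rw [one_div, Real.inv_rpow (by norm_num), Real.rpow_sub (by norm_num), Real.rpow_natCast,
      inv_div, inv_pow, div_eq_mul_inv]
  have hhead : ∑ r ∈ Finset.range k, min 1 (ENNReal.ofReal (2 ^ L * (1 / 2) ^ r)) ≤
      ENNReal.ofReal k := by
    refine (Finset.sum_le_sum fun r _ => min_le_left _ _).trans ?_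
    simp
  have htail : ∑' r : ℕ, min 1 (ENNReal.ofReal (2 ^ L * (1 / 2) ^ (r + k))) ≤
      ENNReal.ofReal (2 * (1 - (k - L) / 2)) := by
    rw [← tsum_ofReal_mul_half_pow (by linarith)]
    refine ENNReal.tsum_le_tsum fun r => (min_le_right _ _).trans (ENNReal.ofReal_le_ofReal ?_)
    rw [pow_add, mul_comm ((1 / 2 : ℝ) ^ r), ← mul_assoc]
    gcongr
  rw [← Summable.sum_add_tsum_nat_add' (k := k) ENNReal.summable]
  refine (add_le_add hhead htail).trans (le_of_eq ?_)
  rw [← ENNReal.ofReal_add (by positivity) (by linarith)]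
  ring_nf

lemma lintegral_tsum_indicator_one_le {α ι : Type*} [MeasurableSpace α] [Countable ι]
    (μ : Measure α) (S : ι → Set α) :
    ∫⁻ x, ∑' k, (S k).indicator 1 x ∂μ ≤ ∑' k, μ (S k) := by
  calc ∫⁻ x, ∑' k, (S k).indicator 1 x ∂μ
      ≤ ∫⁻ x, ∑' k, (toMeasurable μ (S k)).indicator 1 x ∂μ := by
        gcongr with x k
        exact subset_toMeasurable μ (S k)
    _ = ∑' k, μ (S k) := by
        rw [lintegral_tsum fun k => (measurable_one.indicator
          (measurableSet_toMeasurable _ _)).aemeasurable]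
        simp_rw [lintegral_indicator_one (measurableSet_toMeasurable _ _), measure_toMeasurable]

lemma tsum_measure_nearLineAt_le (i : Fin n) :
    ∑' r : ℕ, uniformSample n {P | NearLineAt ((1 / 2) ^ r) P i} ≤
      ENNReal.ofReal (2 * Real.logb 2 n + 8) := by
  have hn : (1 : ℝ) ≤ n := by exact_mod_cast i.pos
  have hlog : 0 ≤ Real.logb 2 n := Real.logb_nonneg one_lt_two hn
  have hpow : (2 : ℝ) ^ (2 * Real.logb 2 n + 6) = 64 * n ^ 2 := by
    rw [Real.rpow_add two_pos, mul_comm 2, Real.rpow_mul two_pos.le,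
      Real.rpow_logb two_pos (by norm_num) (by linarith)]
    norm_num
    ring
  calc ∑' r : ℕ, uniformSample n {P | NearLineAt ((1 / 2) ^ r) P i}
      ≤ ∑' r : ℕ, min 1 (ENNReal.ofReal (2 ^ (2 * Real.logb 2 n + 6) * (1 / 2) ^ r)) := by
        gcongr with r
        refine le_min prob_le_one ((measure_nearLineAt_le (by positivity) i).trans ?_)
        rw [hpow]
        gcongr
        norm_num
    _ ≤ ENNReal.ofReal (2 * Real.logb 2 n + 6 + 2) := tsum_min_one_geometric_le (by linarith)
    _ = _ := by ring_nf

theorem IsGreedy.averageBits_le {A : Algorithm n} (hA : IsGreedy A) :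
    averageBits A ≤ ENNReal.ofReal (4 * n * Real.logb 2 n + 16 * n) := by
  calc averageBits A
      ≤ ∫⁻ P, 2 * ∑' x : Fin n × ℕ,
          {P | NearLineAt ((1 / 2) ^ x.2) P x.1}.indicator 1 P ∂(uniformSample n) := by
        refine lintegral_mono_ae (ae_mem_Icc.mono fun P hP => ?_)
        simpa only [points_inputOf hP] using hA.bitsRead_le (inputOf P)
    _ ≤ 2 * ∑' x : Fin n × ℕ, uniformSample n {P | NearLineAt ((1 / 2) ^ x.2) P x.1} := by
        rw [lintegral_const_mul' _ _ ENNReal.ofNat_ne_top]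
        gcongr
        exact lintegral_tsum_indicator_one_le _ _
    _ ≤ 2 * ∑ _i : Fin n, ENNReal.ofReal (2 * Real.logb 2 n + 8) := by
        rw [ENNReal.tsum_prod', tsum_fintype]
        gcongr with i
        exact tsum_measure_nearLineAt_le i
    _ = ENNReal.ofReal (4 * n * Real.logb 2 n + 16 * n) := by
        rw [Finset.sum_const, Finset.card_univ, Fintype.card_fin, nsmul_eq_mul,
          ← ENNReal.ofReal_natCast, ← ENNReal.ofReal_ofNat 2,
          ← ENNReal.ofReal_mul (by positivity), ← ENNReal.ofReal_mul (by positivity)]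
        ring_nf

/-! ### Corners of the known cells -/

/-- The corners of a known cell, numbered from `0` to `3`: bit `c` of `e` tells whether coordinate
`c` is the lower or the upper end of its dyadic interval. -/
noncomputable def cellCorner (K : Knowledge n) (i : Fin n) (e : ℕ) : Fin 2 → ℝ := fun c =>
  prefixValue (K i c) + (e / 2 ^ (c : ℕ) % 2 : ℕ) * (1 / 2 : ℝ) ^ (K i c).length

lemma cellCorner_mem (K : Knowledge n) (i : Fin n) (e : ℕ) : cellCorner K i e ∈ knownCell K i := by
  intro c
  have hbit : ((e / 2 ^ (c : ℕ) % 2 : ℕ) : ℝ) ≤ 1 := by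
    exact_mod_cast Nat.le_of_lt_succ (Nat.mod_lt _ two_pos)
  have hlen : (0 : ℝ) ≤ (1 / 2) ^ (K i c).length := by positivity
  exact ⟨le_add_of_nonneg_right (by positivity),
    add_le_add le_rfl (mul_le_of_le_one_left hlen hbit)⟩

lemma convex_knownCell (K : Knowledge n) (i : Fin n) : Convex ℝ (knownCell K i) := by
  have hpi : knownCell K i = Set.univ.pi fun c => dyadicInterval (K i c) :=
    Set.ext fun p => by simp only [knownCell, Set.mem_univ_pi]; rfl
  rw [hpi]
  exact convex_pi fun c _ => convex_Icc _ _

lemma exists_cellCorner_ge {f : (Fin 2 → ℝ) → ℝ} (hf : ConvexOn ℝ Set.univ f) {K : Knowledge n}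
    {i : Fin n} {p : Fin 2 → ℝ} (hp : p ∈ knownCell K i) :
    ∃ e < 4, f p ≤ f (cellCorner K i e) := by
  have hull : p ∈ convexHull ℝ (Set.univ.pi fun c =>
      {prefixValue (K i c), prefixValue (K i c) + (1 / 2) ^ (K i c).length}) := by
    rw [convexHull_pi]
    intro c _
    beta_reduce
    rw [convexHull_pair, segment_eq_Icc (le_add_of_nonneg_right (by positivity))]
    exact hp c
  obtain ⟨y, hy, hle⟩ := hf.exists_ge_of_mem_convexHull (Set.subset_univ _) hull
  have hbit (c : Fin 2) :
      ∃ d : ℕ, d < 2 ∧ y c = prefixValue (K i c) + d * (1 / 2) ^ (K i c).length := by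
    rcases hy c trivial with h | h
    · exact ⟨0, two_pos, by simp [h]⟩
    · exact ⟨1, one_lt_two, by simp [Set.mem_singleton_iff.1 h]⟩
  obtain ⟨d, hd, hyd⟩ := hbit 0
  obtain ⟨d', hd', hyd'⟩ := hbit 1
  refine ⟨d + 2 * d', by lia, hle.trans_eq (congrArg f (funext (Fin.forall_fin_two.2 ⟨?_, ?_⟩)))⟩
  · rw [hyd, cellCorner, Fin.val_zero, show (d + 2 * d') / 2 ^ 0 % 2 = d by lia]
  · rw [hyd', cellCorner, Fin.val_one, show (d + 2 * d') / 2 ^ 1 % 2 = d' by lia]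

lemma signedArea_rotate (a b c : Fin 2 → ℝ) : signedArea b c a = signedArea a b c := by
  unfold signedArea
  ring

lemma signedArea_reverse (a b c : Fin 2 → ℝ) : signedArea c b a = -signedArea a b c := by
  unfold signedArea
  ring

lemma convexOn_signedArea (b c : Fin 2 → ℝ) :
    ConvexOn ℝ Set.univ fun a => signedArea a b c := by
  refine ⟨convex_univ, fun x _ y _ s t _ _ hst => le_of_eq ?_⟩
  obtain rfl : t = 1 - s := by linarith
  simp only [signedArea, Pi.add_apply, Pi.smul_apply, smul_eq_mul]
  ring

lemma exists_cellCorner_signedArea_nonneg {K : Knowledge n} {a b c : Fin n} {p q r : Fin 2 → ℝ}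
    (hp : p ∈ knownCell K a) (hq : q ∈ knownCell K b) (hr : r ∈ knownCell K c)
    (h : 0 ≤ signedArea p q r) :
    ∃ e < 4, ∃ f < 4, ∃ g < 4,
      0 ≤ signedArea (cellCorner K a e) (cellCorner K b f) (cellCorner K c g) := by
  obtain ⟨e, he, hpe⟩ := exists_cellCorner_ge (convexOn_signedArea q r) hp
  obtain ⟨f, hf, hqf⟩ := exists_cellCorner_ge (convexOn_signedArea r (cellCorner K a e)) hq
  obtain ⟨g, hg, hrg⟩ :=
    exists_cellCorner_ge (convexOn_signedArea (cellCorner K a e) (cellCorner K b f)) hr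
  refine ⟨e, he, f, hf, g, hg, ?_⟩
  calc 0 ≤ signedArea p q r := h
    _ ≤ signedArea (cellCorner K a e) q r := hpe
    _ = signedArea q r (cellCorner K a e) := (signedArea_rotate ..).symm
    _ ≤ signedArea (cellCorner K b f) r (cellCorner K a e) := hqf
    _ = signedArea r (cellCorner K a e) (cellCorner K b f) := (signedArea_rotate ..).symm
    _ ≤ signedArea (cellCorner K c g) (cellCorner K a e) (cellCorner K b f) := hrg
    _ = signedArea (cellCorner K a e) (cellCorner K b f) (cellCorner K c g) :=
      (signedArea_rotate ..).symm

lemma isPreconnected_knownCell_prod (K : Knowledge n) (a b c : Fin n) :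
    IsPreconnected (knownCell K a ×ˢ knownCell K b ×ˢ knownCell K c) :=
  ((convex_knownCell K a).prod
    ((convex_knownCell K b).prod (convex_knownCell K c))).isPreconnected

lemma unresolved_iff_exists_cellCorner {K : Knowledge n} {a b c : Fin n} :
    Unresolved K a b c ↔ (a ≠ b ∧ b ≠ c ∧ a ≠ c) ∧
      (∃ e < 4, ∃ f < 4, ∃ g < 4,
        0 ≤ signedArea (cellCorner K a e) (cellCorner K b f) (cellCorner K c g)) ∧
      (∃ e < 4, ∃ f < 4, ∃ g < 4,
        0 ≤ signedArea (cellCorner K c e) (cellCorner K b f) (cellCorner K a g)) := by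
  rw [unresolved_iff_exists_signedArea_eq_zero, and_assoc, and_assoc]
  refine and_congr_right' (and_congr_right' (and_congr_right' ⟨?_, ?_⟩))
  · rintro ⟨p, hp, q, hq, r, hr, h⟩
    exact ⟨exists_cellCorner_signedArea_nonneg hp hq hr h.ge,
      exists_cellCorner_signedArea_nonneg hr hq hp (by rw [signedArea_reverse, h, neg_zero])⟩
  · rintro ⟨⟨e, -, f, -, g, -, hpos⟩, ⟨e', -, f', -, g', -, hneg⟩⟩
    rw [signedArea_reverse, Left.nonneg_neg_iff] at hneg
    obtain ⟨⟨p, q, r⟩, ⟨hp, hq, hr⟩, h⟩ :=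
      (isPreconnected_knownCell_prod K a b c).intermediate_value
        (a := (cellCorner K a g', cellCorner K b f', cellCorner K c e'))
        (b := (cellCorner K a e, cellCorner K b f, cellCorner K c g))
        ⟨cellCorner_mem K a g', cellCorner_mem K b f', cellCorner_mem K c e'⟩
        ⟨cellCorner_mem K a e, cellCorner_mem K b f, cellCorner_mem K c g⟩
        continuous_signedArea.continuousOn ⟨hneg, hpos⟩
    exact ⟨p, hp, q, hq, r, hr, h⟩

lemma chirotope_apply_eq_zero (P : Fin n → Fin 2 → ℝ) {a b c : Fin n}
    (h : ¬ (a ≠ b ∧ b ≠ c ∧ a ≠ c)) : chirotope P a b c = 0 := by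
  obtain rfl | rfl | rfl : a = b ∨ b = c ∨ a = c := by tauto
  all_goals
    rw [chirotope, orientation_eq_sign, sign_eq_zero_iff, signedArea]
    ring

lemma chirotope_eq_of_resolved {K : Knowledge n} (hK : ¬ ∃ a b c, Unresolved K a b c)
    {P Q : Fin n → Fin 2 → ℝ} (hP : ∀ i, P i ∈ knownCell K i) (hQ : ∀ i, Q i ∈ knownCell K i) :
    chirotope P = chirotope Q := by
  funext a b c
  by_cases hd : a ≠ b ∧ b ≠ c ∧ a ≠ c
  · have hcont : ContinuousOn (fun T : (Fin 2 → ℝ) × (Fin 2 → ℝ) × (Fin 2 → ℝ) =>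
        SignType.sign (signedArea T.1 T.2.1 T.2.2))
        (knownCell K a ×ˢ knownCell K b ×ˢ knownCell K c) := by
      rintro ⟨p, q, r⟩ ⟨hp, hq, hr⟩
      have hne : signedArea p q r ≠ 0 := fun h0 =>
        hK ⟨a, b, c, unresolved_iff_exists_signedArea_eq_zero.2
          ⟨hd.1, hd.2.1, hd.2.2, p, hp, q, hq, r, hr, h0⟩⟩
      exact ((continuousAt_sign_of_ne_zero hne).comp
        (f := fun T : (Fin 2 → ℝ) × (Fin 2 → ℝ) × (Fin 2 → ℝ) => signedArea T.1 T.2.1 T.2.2)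
        (x := (p, q, r)) continuous_signedArea.continuousAt).continuousWithinAt
    simp only [chirotope, orientation_eq_sign]
    exact (isPreconnected_knownCell_prod K a b c).constant hcont
      (x := (P a, P b, P c)) (y := (Q a, Q b, Q c)) ⟨hP a, hP b, hP c⟩ ⟨hQ a, hQ b, hQ c⟩
  · rw [chirotope_apply_eq_zero P hd, chirotope_apply_eq_zero Q hd]

/-! ### A computable greedy algorithm -/

/-- What has been read, as the input of a Turing machine: the list of the pairs of known
prefixes. -/
abbrev State : Type := List (List (Fin 2) × List (Fin 2))

/-- The state that represents what has been read. -/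
def Knowledge.toState (K : Knowledge n) : State := List.ofFn fun i => (K i 0, K i 1)

/-- The natural number written by a binary string, the most significant bit first. -/
def binaryValue (u : List (Fin 2)) : ℕ := u.foldl (fun (v : ℕ) (b : Fin 2) => 2 * v + b) 0

namespace State

/-- The total number of known bits. -/
def size (L : State) : ℕ := (L.flatMap fun p => p.1 ++ p.2).length

/-- The known prefix of coordinate `c` of the `j`-th point. -/
def coord (L : State) (j c : ℕ) : List (Fin 2) :=
  if c = 0 then (L.getD j ([], [])).1 else (L.getD j ([], [])).2

/-- Coordinate `c` of the corner number `e` of the cell of the `j`-th point, multiplied by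
`2 ^ L.size`, which makes the coordinates of all the corners integers. -/
def corner (L : State) (j e c : ℕ) : ℕ :=
  (binaryValue (L.coord j c) + e / 2 ^ c % 2) * 2 ^ (L.size - (L.coord j c).length)

/-- The positive terms of the determinant that gives the signed area of a triangle of corners. The
negative terms are those of the reversed triangle, so that all computations take place in `ℕ`. -/
def halfArea (L : State) (a b c e f g : ℕ) : ℕ :=
  L.corner a e 0 * L.corner b f 1 + L.corner b f 0 * L.corner c g 1 +
    L.corner c g 0 * L.corner a e 1

/-- Some triangle of corners of the cells of the three points has nonnegative signed area. -/
def SomeAreaNonneg (L : State) (a b c : ℕ) : Prop :=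
  ∃ e < 4, ∃ f < 4, ∃ g < 4, L.halfArea c b a g f e ≤ L.halfArea a b c e f g

/-- The counterpart of `Unresolved` for states. -/
def Ambiguous (L : State) (a b c : ℕ) : Prop :=
  (a ≠ b ∧ b ≠ c ∧ a ≠ c) ∧ L.SomeAreaNonneg a b c ∧ L.SomeAreaNonneg c b a

/-- The `a`-th point has the fewest known bits in some unresolved triple. -/
def Selectable (L : State) (a : ℕ) : Prop :=
  ∃ b < L.length, ∃ c < L.length, L.Ambiguous a b c ∧
    (L.coord a 0).length ≤ (L.coord b 0).length ∧ (L.coord a 0).length ≤ (L.coord c 0).length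

/-- The first coordinate of the `a`-th point has just been read, and the second is to follow. -/
def HalfRead (L : State) (a : ℕ) : Prop :=
  (L.coord a 0).length = (L.coord a 1).length + 1

/-- The orientation of the triangle of the lower left corners of the cells. -/
def sign (L : State) (a b c : ℕ) : ℤ :=
  if L.halfArea c b a 0 0 0 < L.halfArea a b c 0 0 0 then 1
  else if L.halfArea a b c 0 0 0 < L.halfArea c b a 0 0 0 then -1 else 0

instance (L : State) (a b c : ℕ) : Decidable (L.SomeAreaNonneg a b c) := by
  unfold SomeAreaNonneg; infer_instance

instance (L : State) (a b c : ℕ) : Decidable (L.Ambiguous a b c) := by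
  unfold Ambiguous; infer_instance

instance (L : State) : DecidablePred L.Selectable := fun a => by
  unfold Selectable; infer_instance

instance (L : State) : DecidablePred L.HalfRead := fun a => by
  unfold HalfRead; infer_instance

/-- The first half-read point, or `L.length` if there is none. -/
def half (L : State) : ℕ := (List.range L.length).findIdx fun a => decide (L.HalfRead a)

/-- The first selectable point, or `L.length` if there is none. -/
def selected (L : State) : ℕ := (List.range L.length).findIdx fun a => decide (L.Selectable a)

/-- The code of the next action of the greedy algorithm that breaks ties by choosing the smallest
index. -/
def greedyCode (L : State) : (ℕ × ℕ) ⊕ List (List (List ℤ)) :=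
  if L.half < L.length then Sum.inl (L.half, 1)
  else if L.selected < L.length then Sum.inl (L.selected, 0)
  else Sum.inr ((List.range L.length).map fun i => (List.range L.length).map fun j =>
    (List.range L.length).map fun k => L.sign i j k)

end State

section Primrec

variable {α : Type*} [Primcodable α] {L : α → State} {a b c e f g : α → ℕ}

lemma primrecPred_exists_lt {p : α → ℕ → Prop} (hf : Primrec f)
    (hp : PrimrecPred fun x : α × ℕ => p x.1 x.2) : PrimrecPred fun a => ∃ x < f a, p a x := by
  have h : PrimrecRel fun (x : ℕ) (a : α) => p a x := hp.comp (Primrec.snd.pair Primrec.fst)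
  exact (h.exists_mem_list.comp (Primrec.list_range.comp hf) Primrec.id).of_eq (by simp)

lemma primrec_two_pow : Primrec fun n : ℕ => 2 ^ n := by
  refine (Primrec.nat_rec₁ 1 (f := fun _ m => 2 * m)
    (Primrec.nat_mul.comp (Primrec.const 2) Primrec.snd)).of_eq fun n => ?_
  induction n with
  | zero => rfl
  | succ n ih => rw [pow_succ', ← ih]

lemma primrec_binaryValue : Primrec binaryValue := by
  have h : Primrec₂ fun (_ : List (Fin 2)) (p : ℕ × Fin 2) => 2 * p.1 + (p.2 : ℕ) :=
    Primrec.nat_add.comp (Primrec.nat_mul.comp (Primrec.const 2) (Primrec.fst.comp Primrec.snd))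
      ((Primrec.dom_finite (fun b : Fin 2 => (b : ℕ))).comp (Primrec.snd.comp Primrec.snd))
  exact Primrec.list_foldl Primrec.id (Primrec.const 0) h

namespace State

lemma primrec_size : Primrec size :=
  Primrec.list_length.comp (Primrec.list_flatMap Primrec.id
    (Primrec.list_append.comp (Primrec.fst.comp Primrec.snd) (Primrec.snd.comp Primrec.snd)).to₂)

lemma primrec_coord (hL : Primrec L) (ha : Primrec a) (hc : Primrec c) :
    Primrec fun x => (L x).coord (a x) (c x) := by
  have h := (Primrec.list_getD (([], []) : List (Fin 2) × List (Fin 2))).comp hL ha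
  exact Primrec.ite (Primrec.eq.comp hc (Primrec.const 0)) (Primrec.fst.comp h)
    (Primrec.snd.comp h)

lemma primrec_corner (hL : Primrec L) (ha : Primrec a) (he : Primrec e) (c : ℕ) :
    Primrec fun x => (L x).corner (a x) (e x) c := by
  have hcoord := primrec_coord hL ha (Primrec.const c)
  have hbit := Primrec.nat_mod.comp (Primrec.nat_div.comp he (Primrec.const (2 ^ c)))
    (Primrec.const 2)
  exact Primrec.nat_mul.comp (Primrec.nat_add.comp (primrec_binaryValue.comp hcoord) hbit)
    (primrec_two_pow.comp (Primrec.nat_sub.comp (primrec_size.comp hL)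
      (Primrec.list_length.comp hcoord)))

lemma primrec_halfArea (hL : Primrec L) (ha : Primrec a) (hb : Primrec b) (hc : Primrec c)
    (he : Primrec e) (hf : Primrec f) (hg : Primrec g) :
    Primrec fun x => (L x).halfArea (a x) (b x) (c x) (e x) (f x) (g x) :=
  have hA := primrec_corner hL ha he
  have hB := primrec_corner hL hb hf
  have hC := primrec_corner hL hc hg
  Primrec.nat_add.comp (Primrec.nat_add.comp
    (Primrec.nat_mul.comp (hA 0) (hB 1)) (Primrec.nat_mul.comp (hB 0) (hC 1)))
    (Primrec.nat_mul.comp (hC 0) (hA 1))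

lemma primrecPred_someAreaNonneg (hL : Primrec L) (ha : Primrec a) (hb : Primrec b)
    (hc : Primrec c) : PrimrecPred fun x => (L x).SomeAreaNonneg (a x) (b x) (c x) := by
  refine primrecPred_exists_lt (Primrec.const 4) (primrecPred_exists_lt (Primrec.const 4)
    (primrecPred_exists_lt (Primrec.const 4) ?_))
  have hx : Primrec fun y : ((α × ℕ) × ℕ) × ℕ => y.1.1.1 :=
    Primrec.fst.comp (Primrec.fst.comp Primrec.fst)
  have he : Primrec fun y : ((α × ℕ) × ℕ) × ℕ => y.1.1.2 :=
    Primrec.snd.comp (Primrec.fst.comp Primrec.fst)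
  have hf : Primrec fun y : ((α × ℕ) × ℕ) × ℕ => y.1.2 := Primrec.snd.comp Primrec.fst
  exact Primrec.nat_le.comp
    (primrec_halfArea (hL.comp hx) (hc.comp hx) (hb.comp hx) (ha.comp hx) Primrec.snd hf he)
    (primrec_halfArea (hL.comp hx) (ha.comp hx) (hb.comp hx) (hc.comp hx) he hf Primrec.snd)

lemma primrecPred_ambiguous (hL : Primrec L) (ha : Primrec a) (hb : Primrec b)
    (hc : Primrec c) : PrimrecPred fun x => (L x).Ambiguous (a x) (b x) (c x) :=
  ((Primrec.eq.comp ha hb).not.and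
    ((Primrec.eq.comp hb hc).not.and (Primrec.eq.comp ha hc).not)).and
    ((primrecPred_someAreaNonneg hL ha hb hc).and (primrecPred_someAreaNonneg hL hc hb ha))

lemma primrecPred_selectable : PrimrecPred fun x : State × ℕ => x.1.Selectable x.2 := by
  refine primrecPred_exists_lt (Primrec.list_length.comp Primrec.fst)
    (primrecPred_exists_lt (Primrec.list_length.comp (Primrec.fst.comp Primrec.fst)) ?_)
  have hL : Primrec fun y : ((State × ℕ) × ℕ) × ℕ => y.1.1.1 :=
    Primrec.fst.comp (Primrec.fst.comp Primrec.fst)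
  have ha : Primrec fun y : ((State × ℕ) × ℕ) × ℕ => y.1.1.2 :=
    Primrec.snd.comp (Primrec.fst.comp Primrec.fst)
  have hb : Primrec fun y : ((State × ℕ) × ℕ) × ℕ => y.1.2 := Primrec.snd.comp Primrec.fst
  have hlen {j : ((State × ℕ) × ℕ) × ℕ → ℕ} (hj : Primrec j) :=
    Primrec.list_length.comp (primrec_coord hL hj (Primrec.const 0))
  exact (primrecPred_ambiguous hL ha hb Primrec.snd).and
    ((Primrec.nat_le.comp (hlen ha) (hlen hb)).and
      (Primrec.nat_le.comp (hlen ha) (hlen Primrec.snd)))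

lemma primrecPred_halfRead : PrimrecPred fun x : State × ℕ => x.1.HalfRead x.2 :=
  have hlen (c : ℕ) :=
    Primrec.list_length.comp (primrec_coord Primrec.fst Primrec.snd (Primrec.const c))
  Primrec.eq.comp (hlen 0) (Primrec.succ.comp (hlen 1))

lemma primrec_half : Primrec half :=
  Primrec.list_findIdx (Primrec.list_range.comp Primrec.list_length) primrecPred_halfRead.decide

lemma primrec_selected : Primrec selected :=
  Primrec.list_findIdx (Primrec.list_range.comp Primrec.list_length) primrecPred_selectable.decide

lemma primrec_sign (hL : Primrec L) (ha : Primrec a) (hb : Primrec b) (hc : Primrec c) :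
    Primrec fun x => (L x).sign (a x) (b x) (c x) := by
  have h0 := Primrec.const (α := α) 0
  have hpos := primrec_halfArea hL ha hb hc h0 h0 h0
  have hneg := primrec_halfArea hL hc hb ha h0 h0 h0
  exact Primrec.ite (Primrec.nat_lt.comp hneg hpos) (Primrec.const 1)
    (Primrec.ite (Primrec.nat_lt.comp hpos hneg) (Primrec.const (-1)) (Primrec.const 0))

lemma primrec_greedyCode : Primrec greedyCode := by
  have hlen : Primrec fun L : State => L.length := Primrec.list_length
  have hrange : Primrec fun L : State => List.range L.length := Primrec.list_range.comp hlen
  refine Primrec.ite (Primrec.nat_lt.comp primrec_half hlen)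
    (Primrec.sumInl.comp (primrec_half.pair (Primrec.const 1)))
    (Primrec.ite (Primrec.nat_lt.comp primrec_selected hlen)
      (Primrec.sumInl.comp (primrec_selected.pair (Primrec.const 0))) (Primrec.sumInr.comp ?_))
  refine Primrec.list_map hrange (Primrec.list_map (hrange.comp Primrec.fst)
    (Primrec.list_map (hrange.comp (Primrec.fst.comp Primrec.fst)) ?_))
  exact primrec_sign (Primrec.fst.comp (Primrec.fst.comp Primrec.fst))
    (Primrec.snd.comp (Primrec.fst.comp Primrec.fst)) (Primrec.snd.comp Primrec.fst) Primrec.snd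

end State

end Primrec

lemma length_toState (K : Knowledge n) : K.toState.length = n := by simp [Knowledge.toState]

lemma coord_toState (K : Knowledge n) (i : Fin n) (c : Fin 2) : K.toState.coord i c = K i c := by
  fin_cases c <;> simp [State.coord, Knowledge.toState]

lemma size_toState (K : Knowledge n) : K.toState.size = K.size := by
  simp [State.size, Knowledge.toState, Knowledge.size, List.length_flatMap, List.map_ofFn,
    List.sum_ofFn, Fin.sum_univ_two]

lemma length_le_size (K : Knowledge n) (i : Fin n) (c : Fin 2) : (K i c).length ≤ K.size :=
  (Finset.single_le_sum (f := fun c => (K i c).length) (fun _ _ => Nat.zero_le _)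
    (Finset.mem_univ c)).trans
    (Finset.single_le_sum (f := fun i => ∑ c, (K i c).length) (fun _ _ => Nat.zero_le _)
      (Finset.mem_univ i))

lemma natCast_binaryValue (u : List (Fin 2)) :
    (binaryValue u : ℝ) = 2 ^ u.length * prefixValue u := by
  induction u using List.reverseRecOn with
  | nil => simp [binaryValue, prefixValue]
  | append_singleton u b ih =>
    have hsucc : binaryValue (u ++ [b]) = 2 * binaryValue u + b := by simp [binaryValue]
    rw [hsucc, prefixValue_append, List.length_append, List.length_singleton]
    push_cast
    simp only [prefixValue]
    rw [ih, pow_succ, one_div, inv_pow]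
    field_simp
    ring

lemma natCast_corner_toState (K : Knowledge n) (i : Fin n) (e : ℕ) (c : Fin 2) :
    (K.toState.corner i e c : ℝ) = 2 ^ K.size * cellCorner K i e c := by
  rw [State.corner, coord_toState, size_toState, cellCorner]
  push_cast
  rw [natCast_binaryValue, pow_sub₀ _ two_ne_zero (length_le_size K i c), one_div, inv_pow]
  field_simp

lemma halfArea_sub_halfArea_toState (K : Knowledge n) (a b c : Fin n) (e f g : ℕ) :
    (K.toState.halfArea a b c e f g : ℝ) - K.toState.halfArea c b a g f e =
      (2 ^ K.size) ^ 2 * signedArea (cellCorner K a e) (cellCorner K b f) (cellCorner K c g) := by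
  have h0 (i e) := natCast_corner_toState K i e 0
  have h1 (i e) := natCast_corner_toState K i e 1
  simp only [Fin.val_zero, Fin.val_one] at h0 h1
  simp only [State.halfArea, signedArea, Nat.cast_add, Nat.cast_mul, h0, h1]
  ring

lemma halfArea_le_halfArea_toState_iff (K : Knowledge n) (a b c : Fin n) (e f g : ℕ) :
    K.toState.halfArea c b a g f e ≤ K.toState.halfArea a b c e f g ↔
      0 ≤ signedArea (cellCorner K a e) (cellCorner K b f) (cellCorner K c g) := by
  rw [← Nat.cast_le (α := ℝ), ← sub_nonneg, halfArea_sub_halfArea_toState]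
  exact mul_nonneg_iff_of_pos_left (by positivity)

lemma ambiguous_toState_iff {K : Knowledge n} {a b c : Fin n} :
    K.toState.Ambiguous a b c ↔ Unresolved K a b c := by
  simp only [State.Ambiguous, State.SomeAreaNonneg, unresolved_iff_exists_cellCorner, ne_eq,
    Fin.val_inj, halfArea_le_halfArea_toState_iff]

lemma sign_toState (K : Knowledge n) (a b c : Fin n) :
    K.toState.sign a b c = (chirotope (fun i => cellCorner K i 0) a b c : ℤ) := by
  have hpos := halfArea_le_halfArea_toState_iff K c b a 0 0 0
  have hneg := halfArea_le_halfArea_toState_iff K a b c 0 0 0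
  rw [signedArea_reverse, Left.nonneg_neg_iff] at hpos
  simp only [State.sign, chirotope, orientation_eq_sign, ← not_le, hpos, hneg]
  rcases lt_trichotomy 0 (signedArea (cellCorner K a 0) (cellCorner K b 0) (cellCorner K c 0))
    with h | h | h
  · simp [h, not_le.2 h]
  · simp [← h]
  · simp [h, h.le, not_le.2 h]

/-- The greedy algorithm that breaks ties by choosing the smallest index. -/
noncomputable def greedyAlgorithm (n : ℕ) : Algorithm n := fun K =>
  if h : K.toState.half < n then Action.read ⟨K.toState.half, h⟩ 1
  else if h : K.toState.selected < n then Action.read ⟨K.toState.selected, h⟩ 0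
  else Action.output (chirotope fun i => cellCorner K i 0)

lemma map_range_eq_ofFn {β : Type*} (n : ℕ) (g : ℕ → β) :
    (List.range n).map g = List.ofFn fun i : Fin n => g i := by
  rw [List.ofFn_eq_map, ← List.map_coe_finRange_eq_range, List.map_map]
  rfl

lemma greedyCode_toState (n : ℕ) (K : Knowledge n) :
    K.toState.greedyCode = (greedyAlgorithm n K).code := by
  unfold State.greedyCode greedyAlgorithm
  rw [length_toState]
  split_ifs with h1 h2
  · rfl
  · rfl
  · simp only [Action.code, ← sign_toState, map_range_eq_ofFn]

theorem uniformlyComputable_greedyAlgorithm : UniformlyComputable greedyAlgorithm :=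
  ⟨State.greedyCode, State.primrec_greedyCode.to_comp, greedyCode_toState⟩

lemma findIdx_range_lt_iff {p : ℕ → Prop} [DecidablePred p] {m : ℕ} :
    (List.range m).findIdx (fun a => decide (p a)) < m ↔ ∃ a : Fin m, p a := by
  have h := List.findIdx_lt_length (xs := List.range m) (p := fun a => decide (p a))
  rw [List.length_range] at h
  simp [h, Fin.exists_iff]

lemma of_findIdx_range_lt {p : ℕ → Prop} [DecidablePred p] {m : ℕ}
    (h : (List.range m).findIdx (fun a => decide (p a)) < m) :
    p ((List.range m).findIdx fun a => decide (p a)) := by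
  have hlt := h.trans_eq List.length_range.symm
  simpa only [List.getElem_range, decide_eq_true_eq] using List.findIdx_getElem (w := hlt)

lemma halfRead_toState_iff {K : Knowledge n} (a : Fin n) :
    K.toState.HalfRead a ↔ (K a 0).length = (K a 1).length + 1 := by
  rw [State.HalfRead, ← coord_toState K a 0, ← coord_toState K a 1]
  rfl

lemma selectable_toState_iff {K : Knowledge n} (a : Fin n) :
    K.toState.Selectable a ↔ ∃ b c, Unresolved K a b c ∧
      (K a 0).length ≤ (K b 0).length ∧ (K a 0).length ≤ (K c 0).length := by
  have hcoord (i : Fin n) : K.toState.coord i 0 = K i 0 := coord_toState K i 0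
  simp only [← ambiguous_toState_iff, ← hcoord, Fin.exists_iff, State.Selectable, length_toState,
    exists_prop]

lemma half_toState_lt_iff {K : Knowledge n} :
    K.toState.half < n ↔ ∃ a : Fin n, (K a 0).length = (K a 1).length + 1 := by
  simp only [State.half, length_toState, findIdx_range_lt_iff, halfRead_toState_iff]

lemma length_half_toState {K : Knowledge n} (h : K.toState.half < n) :
    (K ⟨K.toState.half, h⟩ 0).length = (K ⟨K.toState.half, h⟩ 1).length + 1 :=
  (halfRead_toState_iff ⟨_, h⟩).1
    (of_findIdx_range_lt (m := K.toState.length) (h.trans_eq (length_toState K).symm))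

lemma selected_toState_lt_iff {K : Knowledge n} :
    K.toState.selected < n ↔ ∃ a b c, Unresolved K a b c ∧
      (K a 0).length ≤ (K b 0).length ∧ (K a 0).length ≤ (K c 0).length := by
  simp only [State.selected, length_toState, findIdx_range_lt_iff, selectable_toState_iff]

lemma exists_unresolved_selected_toState {K : Knowledge n} (h : K.toState.selected < n) :
    ∃ b c, Unresolved K ⟨K.toState.selected, h⟩ b c ∧
      (K ⟨K.toState.selected, h⟩ 0).length ≤ (K b 0).length ∧
      (K ⟨K.toState.selected, h⟩ 0).length ≤ (K c 0).length :=
  (selectable_toState_iff ⟨_, h⟩).1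
    (of_findIdx_range_lt (m := K.toState.length) (h.trans_eq (length_toState K).symm))

lemma Unresolved.rotate {K : Knowledge n} {a b c : Fin n} (h : Unresolved K a b c) :
    Unresolved K b c a := by
  obtain ⟨hab, hbc, hac, x, v, hv, ha, hb, hc⟩ := h
  exact ⟨hbc, hac.symm, hab.symm, x, v, hv, hb, hc, ha⟩

lemma Unresolved.exists_length_le {K : Knowledge n} {a b c : Fin n} (h : Unresolved K a b c) :
    ∃ a b c, Unresolved K a b c ∧ (K a 0).length ≤ (K b 0).length ∧
      (K a 0).length ≤ (K c 0).length := by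
  rcases le_total (K a 0).length (K b 0).length with hab | hba
  · rcases le_total (K a 0).length (K c 0).length with hac | hca
    · exact ⟨a, b, c, h, hab, hac⟩
    · exact ⟨c, a, b, h.rotate.rotate, hca, hca.trans hab⟩
  · rcases le_total (K b 0).length (K c 0).length with hbc | hcb
    · exact ⟨b, c, a, h.rotate, hbc, hba⟩
    · exact ⟨c, a, b, h.rotate.rotate, hcb.trans hba, hcb⟩

lemma Balanced.not_half_toState_lt {K : Knowledge n} (hK : Balanced K) :
    ¬ K.toState.half < n := fun h => by
  have hlen := length_half_toState h
  rw [hK] at hlen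
  lia

theorem isGreedy_greedyAlgorithm (n : ℕ) : IsGreedy (greedyAlgorithm n) where
  select K hK := by
    rintro ⟨_, _, _, h⟩
    have hs : K.toState.selected < n := selected_toState_lt_iff.2 h.exists_length_le
    obtain ⟨b, c, hbc⟩ := exists_unresolved_selected_toState hs
    refine ⟨_, b, c, hbc.1, hbc.2.1, hbc.2.2, ?_⟩
    rw [greedyAlgorithm, dif_neg hK.not_half_toState_lt, dif_pos hs]
  second K i hi hj := by
    have hs : K.toState.half < n := half_toState_lt_iff.2 ⟨i, hi⟩
    have hlen := length_half_toState hs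
    rw [greedyAlgorithm, dif_pos hs]
    congr 1
    by_contra hne
    rw [hj _ hne] at hlen
    lia
  finish K hK hu := by
    refine ⟨chirotope fun i => cellCorner K i 0, ?_, fun P hP =>
      chirotope_eq_of_resolved hu hP fun i => cellCorner_mem K i 0⟩
    rw [greedyAlgorithm, dif_neg hK.not_half_toState_lt, dif_neg]
    exact mt selected_toState_lt_iff.1 fun ⟨a, b, c, h, _⟩ => hu ⟨a, b, c, h⟩

/-! ### When an algorithm may stop -/

lemma uniformSample_eq_restrict :
    uniformSample n = volume.restrict (Set.univ.pi fun _ => Set.Icc 0 1) :=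
  (Measure.restrict_pi_pi _ _).symm

/-- The samples whose coordinates are interior to the known dyadic intervals. -/
def openBox (K : Knowledge n) : Set (Fin n → Fin 2 → ℝ) :=
  {Q | ∀ j c, Q j c ∈ Set.Ioo (prefixValue (K j c))
    (prefixValue (K j c) + (1 / 2 : ℝ) ^ (K j c).length)}

lemma isOpen_openBox (K : Knowledge n) : IsOpen (openBox K) := by
  simp only [openBox, Set.ofPred_forall]
  exact isOpen_iInter_of_finite fun j => isOpen_iInter_of_finite fun c =>
    isOpen_Ioo.preimage (by fun_prop)

lemma openBox_subset_pi_Icc (K : Knowledge n) :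
    openBox K ⊆ Set.univ.pi fun _ => Set.Icc 0 1 := fun _ hQ j _ =>
  ⟨fun c => (prefixValue_nonneg _).trans (hQ j c).1.le,
    fun c => (hQ j c).2.le.trans (prefixValue_add_le_one _)⟩

lemma DeterminesChirotope.frequently_chirotope_eq {A : Algorithm n} (hA : DeterminesChirotope A)
    {w : Input n} {t : ℕ} {χ : Signs n} (ht : A (knowledge A w t) = Action.output χ)
    {Q : Fin n → Fin 2 → ℝ} (hQ : Q ∈ openBox (knowledge A w t)) :
    ∃ᶠ R in nhds Q, chirotope R = χ := by
  have hae : ∀ᵐ R : Fin n → Fin 2 → ℝ, (R ∈ Set.univ.pi fun _ => Set.Icc 0 1) →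
      Outputs A (inputOf R) (chirotope R) := by
    rw [← ae_restrict_iff' (MeasurableSet.univ_pi fun _ => measurableSet_Icc),
      ← uniformSample_eq_restrict]
    exact hA
  have hdense := mem_closure_iff_frequently.1 (Measure.dense_of_ae hae Q)
  refine (hdense.and_eventually ((isOpen_openBox _).mem_nhds hQ)).mono fun R ⟨hout, hR⟩ => ?_
  refine (hout (openBox_subset_pi_Icc _ hR)).unique ⟨t, ?_⟩
  rwa [knowledge_congr A (w' := inputOf R) (fun i c => streamPrefix_bits_eq (hR i c)) le_rfl]

lemma DeterminesChirotope.orientation_eq_of_mem_openBox {A : Algorithm n}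
    (hA : DeterminesChirotope A) {w : Input n} {t : ℕ} {χ : Signs n}
    (ht : A (knowledge A w t) = Action.output χ) {Q : Fin n → Fin 2 → ℝ}
    (hQ : Q ∈ openBox (knowledge A w t)) {a b c : Fin n}
    (h : signedArea (Q a) (Q b) (Q c) ≠ 0) : orientation (Q a) (Q b) (Q c) = χ a b c := by
  have harea : Continuous fun R : Fin n → Fin 2 → ℝ => signedArea (R a) (R b) (R c) :=
    continuous_signedArea.comp (f := fun R : Fin n → Fin 2 → ℝ => (R a, R b, R c)) (by fun_prop)
  have hsign : ∀ᶠ R in nhds Q, orientation (R a) (R b) (R c) = orientation (Q a) (Q b) (Q c) := by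
    simp only [orientation_eq_sign]
    exact ((continuousAt_sign_of_ne_zero h).comp_of_eq harea.continuousAt rfl).eventually_mem
      ((isOpen_discrete {_}).mem_nhds rfl)
  obtain ⟨R, hR, hRQ⟩ := ((hA.frequently_chirotope_eq ht hQ).and_eventually hsign).exists
  rw [← hRQ, ← hR, chirotope]

/-- The end points of dyadic intervals, which almost surely are not coordinates of a sample. -/
def dyadicEnds : Set ℝ :=
  Set.range prefixValue ∪ Set.range fun u : List (Fin 2) => prefixValue u + (1 / 2 : ℝ) ^ u.length

lemma countable_dyadicEnds : dyadicEnds.Countable :=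
  (Set.countable_range _).union (Set.countable_range _)

lemma ae_notMem_dyadicEnds : ∀ᵐ P ∂(uniformSample n), ∀ j c, P j c ∉ dyadicEnds := by
  simp_rw [ae_all_iff]
  intro j c
  refine measure_eq_zero_iff_ae_notMem.1 (nonpos_iff_eq_zero.1 (measure_le_of_setCoord j c
    (measurable_coord j c countable_dyadicEnds.measurableSet) fun P => ?_))
  simp [countable_dyadicEnds.measure_zero]

lemma mem_openBox_knowledge (A : Algorithm n) {P : Fin n → Fin 2 → ℝ}
    (hP : ∀ i c, P i c ∈ Set.Icc (0 : ℝ) 1) (hd : ∀ i c, P i c ∉ dyadicEnds) (t : ℕ) :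
    P ∈ openBox (knowledge A (inputOf P) t) := by
  intro j c
  have hmem := points_mem_knownCell A (inputOf P) t j c
  rw [points_inputOf hP] at hmem
  exact ⟨hmem.1.lt_of_ne fun h => hd j c (Or.inl ⟨_, h⟩),
    hmem.2.lt_of_ne fun h => hd j c (Or.inr ⟨_, h.symm⟩)⟩

lemma setCoord_mem_openBox_knowledge (A : Algorithm n) {P : Fin n → Fin 2 → ℝ} {i : Fin n}
    {d : Fin 2} {t k : ℕ} (hP : P ∈ openBox (knowledge A (inputOf P) t))
    (hlen : (knowledge A (inputOf P) t i d).length ≤ k) {z : ℝ}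
    (hz : z ∈ Set.Ioo (dyadicFloor k (P i d)) (dyadicFloor k (P i d) + (1 / 2) ^ k)) :
    setCoord P i d z ∈ openBox (knowledge A (inputOf P) t) := by
  have hsub := dyadicInterval_subset_of_prefix (streamPrefix_prefix (bits (P i d)) hlen)
  have hknown : streamPrefix (bits (P i d)) (knowledge A (inputOf P) t i d).length =
      knowledge A (inputOf P) t i d := (knowledge_eq_streamPrefix A (inputOf P) t i d).symm
  rw [hknown, dyadicInterval, dyadicInterval, length_streamPrefix,
    Set.Icc_subset_Icc_iff (by simp)] at hsub
  intro j c
  by_cases hj : j = i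
  · subst hj
    by_cases hc : c = d
    · subst hc
      rw [setCoord_self]
      exact ⟨hsub.1.trans_lt hz.1, hz.2.trans_le hsub.2⟩
    · rw [setCoord_of_ne_axis P j z hc]
      exact hP j c
  · rw [setCoord_of_ne P d z hj]
    exact hP j c

/-- The height of a point above the line of ordinate `y` parallel to the axis `d`; the sign
`σ = ±1` selects the side of the line that counts as above. -/
def height (d : Fin 2) (σ y : ℝ) (p : Fin 2 → ℝ) : ℝ := σ * (p (1 - d) - y)

/-- The abscissa of the intersection of the line through `p` and `q` with the line of ordinate `y`
parallel to the axis `d` (`0` if these lines are parallel). -/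
noncomputable def crossingPoint (d : Fin 2) (σ y : ℝ) (p q : Fin 2 → ℝ) : ℝ :=
  (p d * height d σ y q - q d * height d σ y p) / (height d σ y q - height d σ y p)

/-- The line through `p` and `q` crosses the open segment of length `δ` parallel to the axis `d`
that starts at abscissa `s` and ordinate `y`. The heights of the two points are kept in disjoint
ranges, away from `0`, so that the crossing point depends tamely on their abscissas. -/
def Crosses (d : Fin 2) (σ y s δ : ℝ) (p q : Fin 2 → ℝ) : Prop :=
  height d σ y p ∈ Set.Icc (1 / 8) (1 / 4) ∧ height d σ y q ∈ Set.Icc (3 / 8) (1 / 2) ∧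
    crossingPoint d σ y p q ∈ Set.Ioo s (s + δ)

lemma mul_signedArea_eq_crossingPoint (d : Fin 2) (σ : ℝ) {p q r : Fin 2 → ℝ}
    (h : height d σ (r (1 - d)) q - height d σ (r (1 - d)) p ≠ 0) :
    σ * signedArea p q r =
      (if d = 0 then -1 else 1) * (height d σ (r (1 - d)) q - height d σ (r (1 - d)) p) *
        (r d - crossingPoint d σ (r (1 - d)) p q) := by
  rw [crossingPoint, mul_assoc, mul_sub, mul_div_cancel₀ _ h]
  fin_cases d <;> simp [height, signedArea] <;> ring

/-- Moving `P i` along its dyadic segment, on both sides of the line through `P a` and `P b`, would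
change an orientation without contradicting the bits that were read. -/
lemma DeterminesChirotope.lt_length_of_crosses {A : Algorithm n} (hA : DeterminesChirotope A)
    {P : Fin n → Fin 2 → ℝ} {t : ℕ} (hP : P ∈ openBox (knowledge A (inputOf P) t))
    {χ : Signs n} (ht : A (knowledge A (inputOf P) t) = Action.output χ)
    {a b i : Fin n} (hai : a ≠ i) (hbi : b ≠ i) {d : Fin 2} {σ : ℝ} {k : ℕ}
    (hcross : Crosses d σ (P i (1 - d)) (dyadicFloor k (P i d)) ((1 / 2) ^ k) (P a) (P b)) :
    k < (knowledge A (inputOf P) t i d).length := by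
  by_contra! hlen
  obtain ⟨ha, hb, hx⟩ := hcross
  set x := crossingPoint d σ (P i (1 - d)) (P a) (P b)
  have hab : height d σ (P i (1 - d)) (P b) - height d σ (P i (1 - d)) (P a) ≠ 0 := by
    linarith [ha.2, hb.1]
  obtain ⟨κ, hκ, harea⟩ : ∃ κ : ℝ, κ ≠ 0 ∧ ∀ z, σ * signedArea (setCoord P i d z a)
      (setCoord P i d z b) (setCoord P i d z i) = κ * (z - x) := by
    refine ⟨(if d = 0 then -1 else 1) * (height d σ (P i (1 - d)) (P b) -
      height d σ (P i (1 - d)) (P a)), mul_ne_zero (by split_ifs <;> norm_num) hab, fun z => ?_⟩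
    have hi := setCoord_of_ne_axis P i z (one_sub_ne_self d)
    rw [setCoord_of_ne P d z hai, setCoord_of_ne P d z hbi, mul_signedArea_eq_crossingPoint d σ
      (by rwa [hi]), hi, setCoord_self]
  have hsign : ∀ z ∈ Set.Ioo (dyadicFloor k (P i d)) (dyadicFloor k (P i d) + (1 / 2) ^ k),
      z ≠ x → SignType.sign κ * SignType.sign (z - x) = SignType.sign σ * χ a b i := by
    intro z hz hzx
    have hne : σ * signedArea (setCoord P i d z a) (setCoord P i d z b) (setCoord P i d z i) ≠ 0 :=
      harea z ▸ mul_ne_zero hκ (sub_ne_zero.2 hzx)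
    rw [← hA.orientation_eq_of_mem_openBox ht (setCoord_mem_openBox_knowledge A hP hlen hz)
      (right_ne_zero_of_mul hne), orientation_eq_sign, ← sign_mul, ← sign_mul, harea]
  obtain ⟨z₁, hz₁, hz₁x⟩ := exists_between hx.1
  obtain ⟨z₂, hxz₂, hz₂⟩ := exists_between hx.2
  have heq := (hsign z₁ ⟨hz₁, hz₁x.trans hx.2⟩ hz₁x.ne).trans
    (hsign z₂ ⟨hx.1.trans hxz₂, hz₂⟩ hxz₂.ne').symm
  rw [sign_neg (sub_neg.2 hz₁x), sign_pos (sub_pos.2 hxz₂), mul_neg, mul_one,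
    SignType.neg_eq_self_iff, sign_eq_zero_iff] at heq
  exact hκ heq

/-! ### The probability that a line through two random points crosses a segment -/

lemma measurableSet_crosses {Ω : Type*} [MeasurableSpace Ω] (d : Fin 2) {σ y s : Ω → ℝ} (δ : ℝ)
    {p q : Ω → Fin 2 → ℝ} (hσ : Measurable σ) (hy : Measurable y) (hs : Measurable s)
    (hp : Measurable p) (hq : Measurable q) :
    MeasurableSet {ω | Crosses d (σ ω) (y ω) (s ω) δ (p ω) (q ω)} := by
  have hheight {r : Ω → Fin 2 → ℝ} (hr : Measurable r) :
      Measurable fun ω => height d (σ ω) (y ω) (r ω) :=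
    hσ.mul ((hr.eval (a := 1 - d)).sub hy)
  have hcrossing : Measurable fun ω => crossingPoint d (σ ω) (y ω) (p ω) (q ω) :=
    ((hp.eval.mul (hheight hq)).sub (hq.eval.mul (hheight hp))).div
      ((hheight hq).sub (hheight hp))
  exact (hheight hp measurableSet_Icc).inter ((hheight hq measurableSet_Icc).inter
    ((measurableSet_lt hs hcrossing).inter (measurableSet_lt hcrossing (hs.add_const δ))))

/-- The samples for which the points `a` and `b` have the heights required by `Crosses`. -/
def bandEvent (d : Fin 2) (σ y : ℝ) (a b : Fin n) : Set (Fin n → Fin 2 → ℝ) :=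
  {P | height d σ y (P a) ∈ Set.Icc (1 / 8) (1 / 4) ∧ height d σ y (P b) ∈ Set.Icc (3 / 8) (1 / 2)}

/-- The samples for which the line through the points `a` and `b` crosses a given segment. -/
def crossEvent (d : Fin 2) (σ y s δ : ℝ) (a b : Fin n) : Set (Fin n → Fin 2 → ℝ) :=
  {P | Crosses d σ y s δ (P a) (P b)}

lemma measurable_height_coord (d : Fin 2) (σ y : ℝ) (a : Fin n) :
    Measurable fun P : Fin n → Fin 2 → ℝ => height d σ y (P a) :=
  ((measurable_coord a (1 - d)).sub_const y).const_mul σ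

lemma measurableSet_bandEvent (d : Fin 2) (σ y : ℝ) (a b : Fin n) :
    MeasurableSet (bandEvent d σ y a b) :=
  (measurable_height_coord d σ y a measurableSet_Icc).inter
    (measurable_height_coord d σ y b measurableSet_Icc)

lemma measurableSet_crossEvent (d : Fin 2) (σ y s δ : ℝ) (a b : Fin n) :
    MeasurableSet (crossEvent d σ y s δ a b) :=
  measurableSet_crosses d δ measurable_const measurable_const measurable_const
    (measurable_pi_apply a) (measurable_pi_apply b)

lemma height_setCoord (d : Fin 2) (σ y : ℝ) (P : Fin n → Fin 2 → ℝ) (c j : Fin n) (z : ℝ) :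
    height d σ y (setCoord P c d z j) = height d σ y (P j) := by
  unfold height
  by_cases h : j = c
  · rw [h, setCoord_of_ne_axis P c z (one_sub_ne_self d)]
  · rw [setCoord_of_ne P d z h]

section

variable {d : Fin 2} {σ y s δ : ℝ} {P : Fin n → Fin 2 → ℝ} {a b : Fin n}

lemma mem_bandEvent_of_setCoord_mem {c : Fin n} {z : ℝ}
    (h : setCoord P c d z ∈ crossEvent d σ y s δ a b) : P ∈ bandEvent d σ y a b := by
  obtain ⟨ha, hb, -⟩ := h
  rw [height_setCoord] at ha hb
  exact ⟨ha, hb⟩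

lemma setCoord_mem_crossEvent_iff {c : Fin n} {z : ℝ} (hac : a ≠ c) (hbc : b ≠ c) :
    setCoord P c d z ∈ crossEvent d σ y s δ a b ↔ P ∈ crossEvent d σ y s δ a b := by
  simp only [crossEvent, Set.mem_ofPred_eq, setCoord_of_ne P d z hac, setCoord_of_ne P d z hbc]

lemma setOf_setCoord_fst_mem_crossEvent (hab : a ≠ b) (hP : P ∈ bandEvent d σ y a b) :
    {z | setCoord P a d z ∈ crossEvent d σ y s δ a b} =
      Set.Ioo ((s * (height d σ y (P b) - height d σ y (P a)) + P b d * height d σ y (P a)) /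
          height d σ y (P b))
        (((s + δ) * (height d σ y (P b) - height d σ y (P a)) + P b d * height d σ y (P a)) /
          height d σ y (P b)) := by
  obtain ⟨ha, hb⟩ := hP
  have hlt : 0 < height d σ y (P b) - height d σ y (P a) := by linarith [ha.2, hb.1]
  have hpos : 0 < height d σ y (P b) := by linarith [hb.1]
  ext z
  simp only [crossEvent, Crosses, Set.mem_ofPred_eq, height_setCoord, ha, hb, true_and,
    crossingPoint, setCoord_self, setCoord_of_ne P d z hab.symm, Set.mem_Ioo]
  rw [lt_div_iff₀ hlt, div_lt_iff₀ hlt, div_lt_iff₀ hpos, lt_div_iff₀ hpos]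
  constructor <;> rintro ⟨hl, hr⟩ <;> constructor <;> linarith

lemma setOf_setCoord_snd_mem_crossEvent (hab : a ≠ b) (hP : P ∈ bandEvent d σ y a b) :
    {z | setCoord P b d z ∈ crossEvent d σ y s δ a b} =
      Set.Ioo ((P a d * height d σ y (P b) - (s + δ) * (height d σ y (P b) - height d σ y (P a))) /
          height d σ y (P a))
        ((P a d * height d σ y (P b) - s * (height d σ y (P b) - height d σ y (P a))) /
          height d σ y (P a)) := by
  obtain ⟨ha, hb⟩ := hP
  have hlt : 0 < height d σ y (P b) - height d σ y (P a) := by linarith [ha.2, hb.1]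
  have hpos : 0 < height d σ y (P a) := by linarith [ha.1]
  ext z
  simp only [crossEvent, Crosses, Set.mem_ofPred_eq, height_setCoord, ha, hb, true_and,
    crossingPoint, setCoord_self, setCoord_of_ne P d z hab, Set.mem_Ioo]
  rw [lt_div_iff₀ hlt, div_lt_iff₀ hlt, div_lt_iff₀ hpos, lt_div_iff₀ hpos]
  constructor <;> rintro ⟨hl, hr⟩ <;> constructor <;> linarith

lemma volume_setCoord_fst_mem_crossEvent_le (hδ : 0 ≤ δ) (hab : a ≠ b) :
    volume {z | setCoord P a d z ∈ crossEvent d σ y s δ a b} ≤ ENNReal.ofReal δ := by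
  by_cases hP : P ∈ bandEvent d σ y a b
  · rw [setOf_setCoord_fst_mem_crossEvent hab hP, Real.volume_Ioo]
    refine ENNReal.ofReal_le_ofReal ?_
    have ha := hP.1.1
    have hb := hP.2.1
    rw [← sub_div, div_le_iff₀ (by linarith)]
    nlinarith
  · simp [mt mem_bandEvent_of_setCoord_mem hP]

lemma volume_setCoord_snd_mem_crossEvent_le (hδ : 0 ≤ δ) (hab : a ≠ b) :
    volume {z | setCoord P b d z ∈ crossEvent d σ y s δ a b} ≤ ENNReal.ofReal (3 * δ) := by
  by_cases hP : P ∈ bandEvent d σ y a b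
  · rw [setOf_setCoord_snd_mem_crossEvent hab hP, Real.volume_Ioo]
    refine ENNReal.ofReal_le_ofReal ?_
    have ha := hP.1.1
    have hb := hP.2.2
    rw [← sub_div, div_le_iff₀ (by linarith)]
    nlinarith
  · simp [mt mem_bandEvent_of_setCoord_mem hP]

lemma le_volume_setCoord_fst_mem_crossEvent (hδ : 0 ≤ δ) (hs : 0 ≤ s) (hsδ : s + δ ≤ 1)
    (hab : a ≠ b) (hP : P ∈ bandEvent d σ y a b) (hPb : P b d ∈ Set.Icc (0 : ℝ) 1) :
    ENNReal.ofReal (δ / 4) ≤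
      volume ({z | setCoord P a d z ∈ crossEvent d σ y s δ a b} ∩ Set.Icc 0 1) := by
  rw [setOf_setCoord_fst_mem_crossEvent hab hP]
  obtain ⟨⟨ha0, ha1⟩, hb0, hb1⟩ := hP
  obtain ⟨hx0, hx1⟩ := hPb
  generalize height d σ y (P a) = p at *
  generalize height d σ y (P b) = q at *
  have hq : 0 < q := by linarith
  rw [Set.inter_eq_left.2, Real.volume_Ioo]
  · refine ENNReal.ofReal_le_ofReal ?_
    rw [← sub_div, le_div_iff₀ hq]
    nlinarith
  · refine Set.Ioo_subset_Icc_self.trans (Set.Icc_subset_Icc ?_ ?_)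
    · exact div_nonneg (add_nonneg (mul_nonneg hs (by linarith)) (mul_nonneg hx0 (by linarith)))
        hq.le
    · rw [div_le_one hq]
      nlinarith

end

section

variable {d : Fin 2} {σ y s δ : ℝ}

lemma measure_crossEvent_le (hδ : 0 ≤ δ) {a b : Fin n} (hab : a ≠ b) :
    uniformSample n (crossEvent d σ y s δ a b) ≤ ENNReal.ofReal δ :=
  measure_le_of_setCoord a d (measurableSet_crossEvent d σ y s δ a b)
    fun _ => volume_setCoord_fst_mem_crossEvent_le hδ hab

lemma measure_crossEvent_inter_fst_le (hδ : 0 ≤ δ) {a b b' : Fin n} (hab : a ≠ b) (hab' : a ≠ b')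
    (hbb' : b ≠ b') :
    uniformSample n (crossEvent d σ y s δ a b ∩ crossEvent d σ y s δ a b') ≤
      ENNReal.ofReal (3 * δ ^ 2) := by
  have hm (c : Fin n) := measurableSet_crossEvent d σ y s δ a c
  calc uniformSample n (crossEvent d σ y s δ a b ∩ crossEvent d σ y s δ a b')
      ≤ ENNReal.ofReal (3 * δ) * uniformSample n (crossEvent d σ y s δ a b') :=
        measure_le_mul_of_setCoord b d ((hm b).inter (hm b')) (hm b')
          (fun P z hz => (setCoord_mem_crossEvent_iff hab hbb'.symm).1 hz.2)
          fun P _ => (measure_mono fun z hz => hz.1).trans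
            (volume_setCoord_snd_mem_crossEvent_le hδ hab)
    _ ≤ ENNReal.ofReal (3 * δ) * ENNReal.ofReal δ := by gcongr; exact measure_crossEvent_le hδ hab'
    _ = ENNReal.ofReal (3 * δ ^ 2) := by rw [← ENNReal.ofReal_mul (by positivity)]; ring_nf

lemma measure_crossEvent_inter_snd_le (hδ : 0 ≤ δ) {a a' b : Fin n} (hab : a ≠ b) (hab' : a' ≠ b)
    (haa' : a ≠ a') :
    uniformSample n (crossEvent d σ y s δ a b ∩ crossEvent d σ y s δ a' b) ≤
      ENNReal.ofReal (δ ^ 2) := by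
  have hm (c : Fin n) := measurableSet_crossEvent d σ y s δ c b
  calc uniformSample n (crossEvent d σ y s δ a b ∩ crossEvent d σ y s δ a' b)
      ≤ ENNReal.ofReal δ * uniformSample n (crossEvent d σ y s δ a' b) :=
        measure_le_mul_of_setCoord a d ((hm a).inter (hm a')) (hm a')
          (fun P z hz => (setCoord_mem_crossEvent_iff haa'.symm hab.symm).1 hz.2)
          fun P _ => (measure_mono fun z hz => hz.1).trans
            (volume_setCoord_fst_mem_crossEvent_le hδ hab)
    _ ≤ ENNReal.ofReal δ * ENNReal.ofReal δ := by gcongr; exact measure_crossEvent_le hδ hab'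
    _ = ENNReal.ofReal (δ ^ 2) := by rw [← ENNReal.ofReal_mul hδ, sq]

/-- The side of the line of ordinate `y` on which the unit square is the widest. -/
noncomputable def wideSide (y : ℝ) : ℝ := if y ≤ 1 / 2 then 1 else -1

lemma measurable_wideSide : Measurable wideSide :=
  Measurable.ite measurableSet_Iic measurable_const measurable_const

lemma le_volume_strip (hy : y ∈ Set.Icc (0 : ℝ) 1) {α β : ℝ} (hα : 0 ≤ α) (hβ : β ≤ 1 / 2) :
    ENNReal.ofReal (β - α) ≤ volume ({z | wideSide y * (z - y) ∈ Set.Icc α β} ∩ Set.Icc 0 1) := by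
  obtain ⟨hy0, hy1⟩ := hy
  unfold wideSide
  split_ifs with h
  · calc ENNReal.ofReal (β - α) = volume (Set.Icc (y + α) (y + β)) := by
          rw [Real.volume_Icc]; ring_nf
      _ ≤ volume ({z | 1 * (z - y) ∈ Set.Icc α β} ∩ Set.Icc 0 1) := measure_mono
          fun z ⟨hl, hr⟩ => ⟨⟨by linarith, by linarith⟩, by linarith, by linarith⟩
  · calc ENNReal.ofReal (β - α) = volume (Set.Icc (y - β) (y - α)) := by
          rw [Real.volume_Icc]; ring_nf
      _ ≤ volume ({z | -1 * (z - y) ∈ Set.Icc α β} ∩ Set.Icc 0 1) := measure_mono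
          fun z ⟨hl, hr⟩ => ⟨⟨by linarith, by linarith⟩, by linarith, by linarith⟩

lemma le_measure_bandEvent (hy : y ∈ Set.Icc (0 : ℝ) 1) {a b : Fin n} (hab : a ≠ b) :
    ENNReal.ofReal (1 / 64) ≤ uniformSample n (bandEvent d (wideSide y) y a b) := by
  have hstrip (c : Fin n) (P : Fin n → Fin 2 → ℝ) {α β : ℝ} (hα : 0 ≤ α) (hβ : β ≤ 1 / 2) :
      ENNReal.ofReal (β - α) ≤ volume
        ({z | height d (wideSide y) y (setCoord P c (1 - d) z c) ∈ Set.Icc α β} ∩ Set.Icc 0 1) := by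
    simpa only [height, setCoord_self] using le_volume_strip hy hα hβ
  set T := {P : Fin n → Fin 2 → ℝ | height d (wideSide y) y (P b) ∈ Set.Icc (3 / 8) (1 / 2)}
  have hTm : MeasurableSet T := measurable_height_coord d _ y b measurableSet_Icc
  have hT : ENNReal.ofReal (1 / 2 - 3 / 8) ≤ uniformSample n T := by
    simpa using mul_measure_le_of_setCoord b (1 - d) hTm MeasurableSet.univ
      fun P _ => hstrip b P (by norm_num) le_rfl
  calc ENNReal.ofReal (1 / 64)
      = ENNReal.ofReal (1 / 4 - 1 / 8) * ENNReal.ofReal (1 / 2 - 3 / 8) := by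
        rw [← ENNReal.ofReal_mul (by norm_num)]; norm_num
    _ ≤ ENNReal.ofReal (1 / 4 - 1 / 8) * uniformSample n T := by gcongr
    _ ≤ _ := mul_measure_le_of_setCoord a (1 - d) (measurableSet_bandEvent d _ y a b) hTm
        fun P hP => (hstrip a P (by norm_num) (by norm_num)).trans <| measure_mono
          fun z hz => ⟨⟨hz.1, by rwa [setCoord_of_ne P _ z hab.symm]⟩, hz.2⟩

lemma le_measure_crossEvent (hy : y ∈ Set.Icc (0 : ℝ) 1) (hs : 0 ≤ s) (hδ : 0 ≤ δ)
    (hsδ : s + δ ≤ 1) {a b : Fin n} (hab : a ≠ b) :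
    ENNReal.ofReal (δ / 256) ≤ uniformSample n (crossEvent d (wideSide y) y s δ a b) := by
  set B := bandEvent d (wideSide y) y a b
  set T := {P : Fin n → Fin 2 → ℝ | P b d ∈ Set.Icc (0 : ℝ) 1}
  have hTm : MeasurableSet T := measurable_coord b d measurableSet_Icc
  have hT : T ∈ ae (uniformSample n) := ae_mem_Icc.mono fun P hP => hP b d
  calc ENNReal.ofReal (δ / 256) = ENNReal.ofReal (δ / 4) * ENNReal.ofReal (1 / 64) := by
        rw [← ENNReal.ofReal_mul (by positivity)]; ring_nf
    _ ≤ ENNReal.ofReal (δ / 4) * uniformSample n B := by gcongr; exact le_measure_bandEvent hy hab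
    _ = ENNReal.ofReal (δ / 4) * uniformSample n (B ∩ T) := by
        rw [measure_inter_conull hT]
    _ ≤ _ := mul_measure_le_of_setCoord a d (measurableSet_crossEvent d _ y s δ a b)
        ((measurableSet_bandEvent d _ y a b).inter hTm)
        fun P hP => le_volume_setCoord_fst_mem_crossEvent hδ hs hsδ hab hP.1 hP.2

end

/-! ### The second moment method -/

section SecondMoment

open ProbabilityTheory

section

variable {Ω ι : Type*} [MeasurableSpace Ω] {μ : Measure Ω}

lemma memLp_indicator_one [IsFiniteMeasure μ] {E : Set Ω} (hE : MeasurableSet E) :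
    MemLp (E.indicator (1 : Ω → ℝ)) 2 μ :=
  memLp_indicator_const 2 hE (1 : ℝ) (Or.inr (measure_ne_top μ E))

lemma covariance_indicator_le [IsProbabilityMeasure μ] {E F : Set Ω} (hE : MeasurableSet E)
    (hF : MeasurableSet F) : cov[E.indicator 1, F.indicator 1; μ] ≤ μ.real (E ∩ F) := by
  rw [covariance_eq_sub (memLp_indicator_one hE) (memLp_indicator_one hF),
    ← Set.inter_indicator_one, integral_indicator_one (hE.inter hF), integral_indicator_one hE,
    integral_indicator_one hF]
  exact sub_le_self _ (by positivity)

lemma measure_forall_notMem_le [IsFiniteMeasure μ] {S : Finset ι} {E : ι → Set Ω}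
    (hE : ∀ x, MeasurableSet (E x)) {p V : ℝ} (hp : 0 < p) (hS : S.Nonempty)
    (hpE : ∀ x ∈ S, p ≤ μ.real (E x))
    (hV : ∑ x ∈ S, ∑ y ∈ S, cov[(E x).indicator 1, (E y).indicator 1; μ] ≤ V) :
    μ {ω | ∀ x ∈ S, ω ∉ E x} ≤ ENNReal.ofReal (V / (S.card * p) ^ 2) := by
  set X : Ω → ℝ := fun ω => ∑ x ∈ S, (E x).indicator (1 : Ω → ℝ) ω
  have hLp : ∀ x ∈ S, MemLp ((E x).indicator (1 : Ω → ℝ)) 2 μ :=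
    fun x _ => memLp_indicator_one (hE x)
  have hvar : Var[X; μ] ≤ V := (variance_fun_sum' hLp).trans_le hV
  have hmean : S.card * p ≤ ∫ ω, X ω ∂μ := by
    rw [integral_finsetSum _ fun x hx => (hLp x hx).integrable one_le_two, ← nsmul_eq_mul]
    simp_rw [integral_indicator_one (hE _)]
    exact Finset.card_nsmul_le_sum S _ p hpE
  have hpos : 0 < S.card * p := mul_pos (by exact_mod_cast hS.card_pos) hp
  calc μ {ω | ∀ x ∈ S, ω ∉ E x} ≤ μ {ω | S.card * p ≤ |X ω - ∫ ω, X ω ∂μ|} :=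
        measure_mono fun ω hω => by
          have hX : X ω = 0 := Finset.sum_eq_zero fun x hx => Set.indicator_of_notMem (hω x hx) _
          simpa only [Set.mem_ofPred_eq, hX, zero_sub, abs_neg] using hmean.trans (le_abs_self _)
    _ ≤ ENNReal.ofReal (Var[X; μ] / (S.card * p) ^ 2) :=
        meas_ge_le_variance_div_sq (memLp_finsetSum _ hLp) hpos
    _ ≤ ENNReal.ofReal (V / (S.card * p) ^ 2) := by gcongr

end

variable {d : Fin 2} {σ y s δ : ℝ}

-- The bands of heights of the two points in `Crosses` are disjoint.
lemma crossEvent_inter_eq_empty {a b a' b' : Fin n} (h : a = b' ∨ b = a') :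
    crossEvent d σ y s δ a b ∩ crossEvent d σ y s δ a' b' = ∅ := by
  refine Set.eq_empty_of_forall_notMem ?_
  rintro P ⟨⟨ha, hb, -⟩, ha', hb', -⟩
  rcases h with rfl | rfl
  · linarith [ha.2, hb'.1]
  · linarith [hb.1, ha'.2]

lemma covariance_crossEvent_nonpos {a b a' b' : Fin n} (haa' : a ≠ a') (hbb' : b ≠ b') :
    cov[(crossEvent d σ y s δ a b).indicator 1, (crossEvent d σ y s δ a' b').indicator 1;
      uniformSample n] ≤ 0 := by
  have hm (a b : Fin n) := measurableSet_crossEvent d σ y s δ a b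
  by_cases h : a = b' ∨ b = a'
  · simpa [crossEvent_inter_eq_empty h] using
      covariance_indicator_le (μ := uniformSample n) (hm a b) (hm a' b')
  push Not at h
  have hpoints : iIndepFun (fun (i : Fin n) (P : Fin n → Fin 2 → ℝ) => P i) (uniformSample n) :=
    iIndepFun_pi (X := fun _ => id) fun _ => aemeasurable_id
  have hpairs := hpoints.indepFun_prodMk_prodMk measurable_pi_apply a b a' b' haa' h.1 h.2 hbb'
  have hind : Measurable ({p : (Fin 2 → ℝ) × (Fin 2 → ℝ) | Crosses d σ y s δ p.1 p.2}.indicator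
      (1 : (Fin 2 → ℝ) × (Fin 2 → ℝ) → ℝ)) :=
    measurable_one.indicator (measurableSet_crosses d δ measurable_const measurable_const
      measurable_const measurable_fst measurable_snd)
  exact ((hpairs.comp hind hind).covariance_eq_zero (memLp_indicator_one (hm a b))
    (memLp_indicator_one (hm a' b'))).le

lemma covariance_crossEvent_le (hδ : 0 ≤ δ) {x z : Fin n × Fin n} (hx : x.1 ≠ x.2)
    (hz : z.1 ≠ z.2) :
    cov[(crossEvent d σ y s δ x.1 x.2).indicator 1, (crossEvent d σ y s δ z.1 z.2).indicator 1;
      uniformSample n] ≤ (if x = z then δ else 0) + (if x.1 = z.1 then 3 * δ ^ 2 else 0) +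
        (if x.2 = z.2 then δ ^ 2 else 0) := by
  obtain ⟨a, b⟩ := x
  obtain ⟨a', b'⟩ := z
  have hle {r : ℝ} (hr : 0 ≤ r) (h : uniformSample n
      (crossEvent d σ y s δ a b ∩ crossEvent d σ y s δ a' b') ≤ ENNReal.ofReal r) :
      cov[(crossEvent d σ y s δ a b).indicator 1, (crossEvent d σ y s δ a' b').indicator 1;
        uniformSample n] ≤ r :=
    (covariance_indicator_le (measurableSet_crossEvent ..) (measurableSet_crossEvent ..)).trans
      (ENNReal.toReal_le_of_le_ofReal hr h)
  have hsq : 0 ≤ δ ^ 2 := sq_nonneg δ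
  rcases eq_or_ne a a' with rfl | haa' <;> rcases eq_or_ne b b' with rfl | hbb'
  · refine (hle hδ (by rw [Set.inter_self]; exact measure_crossEvent_le hδ hx)).trans ?_
    simp only [if_true]
    linarith
  · simpa [hbb'] using hle (by positivity) (measure_crossEvent_inter_fst_le hδ hx hz hbb')
  · simpa [haa'] using hle hsq (measure_crossEvent_inter_snd_le hδ hx hz haa')
  · simpa [haa', hbb'] using covariance_crossEvent_nonpos haa' hbb'

/-- The ordered pairs of distinct indices that are different from `i`. -/
def otherPairs (i : Fin n) : Finset (Fin n × Fin n) := (Finset.univ.erase i).offDiag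

lemma mem_otherPairs {i : Fin n} {x : Fin n × Fin n} :
    x ∈ otherPairs i ↔ x.1 ≠ i ∧ x.2 ≠ i ∧ x.1 ≠ x.2 := by
  simp [otherPairs, Finset.mem_offDiag]

lemma card_otherPairs (i : Fin n) : ((otherPairs i).card : ℝ) = (n - 1) * (n - 2) := by
  have hn : 1 ≤ n := i.pos
  rw [otherPairs, Finset.offDiag_card, Finset.card_erase_of_mem (Finset.mem_univ i),
    Finset.card_univ, Fintype.card_fin, Nat.cast_sub (Nat.le_mul_self _)]
  push_cast [hn]
  ring

lemma sum_covariance_crossEvent_le (hδ : 0 ≤ δ) (i : Fin n) :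
    ∑ x ∈ otherPairs i, ∑ z ∈ otherPairs i,
      cov[(crossEvent d σ y s δ x.1 x.2).indicator 1, (crossEvent d σ y s δ z.1 z.2).indicator 1;
        uniformSample n] ≤ (otherPairs i).card * (δ + 4 * n * δ ^ 2) := by
  rw [← nsmul_eq_mul]
  refine Finset.sum_le_card_nsmul _ _ _ fun x hx => ?_
  calc _ ≤ ∑ z ∈ otherPairs i, ((if x = z then δ else 0) +
          (if x.1 = z.1 then 3 * δ ^ 2 else 0) + (if x.2 = z.2 then δ ^ 2 else 0)) :=
        Finset.sum_le_sum fun z hz => covariance_crossEvent_le hδ (mem_otherPairs.1 hx).2.2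
          (mem_otherPairs.1 hz).2.2
    _ ≤ ∑ z, ((if x = z then δ else 0) + (if x.1 = z.1 then 3 * δ ^ 2 else 0) +
          (if x.2 = z.2 then δ ^ 2 else 0)) :=
        Finset.sum_le_univ_sum_of_nonneg fun z => by positivity
    _ = δ + 4 * n * δ ^ 2 := by
        have hfst (r : ℝ) : ∑ z : Fin n × Fin n, (if x.1 = z.1 then r else 0) = n * r := by
          simp [Fintype.sum_prod_type_right]
        have hsnd (r : ℝ) : ∑ z : Fin n × Fin n, (if x.2 = z.2 then r else 0) = n * r := by
          simp [Fintype.sum_prod_type]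
        rw [Finset.sum_add_distrib, Finset.sum_add_distrib, hfst, hsnd, Finset.sum_ite_eq,
          if_pos (Finset.mem_univ x)]
        ring

lemma measure_forall_not_crosses_le (hy : y ∈ Set.Icc (0 : ℝ) 1) (hs : 0 ≤ s) (hδ : 0 < δ)
    (hsδ : s + δ ≤ 1) (hn : 3 ≤ n) (i : Fin n) :
    uniformSample n {P | ∀ x ∈ otherPairs i, ¬ Crosses d (wideSide y) y s δ (P x.1) (P x.2)} ≤
      ENNReal.ofReal (65536 * (1 + 4 * n * δ) / ((n - 1) * (n - 2) * δ)) := by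
  have hn' : (3 : ℝ) ≤ n := by exact_mod_cast hn
  have hcard : (0 : ℝ) < (otherPairs i).card := by
    rw [card_otherPairs]
    exact mul_pos (by linarith) (by linarith)
  have hprob : ∀ x ∈ otherPairs i,
      δ / 256 ≤ (uniformSample n).real (crossEvent d (wideSide y) y s δ x.1 x.2) := fun x hx =>
    (ENNReal.ofReal_le_iff_le_toReal (measure_ne_top _ _)).1
      (le_measure_crossEvent hy hs hδ.le hsδ (mem_otherPairs.1 hx).2.2)
  have hcov := sum_covariance_crossEvent_le (d := d) (σ := wideSide y) (y := y) (s := s) hδ.le i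
  refine (measure_forall_notMem_le (fun x => measurableSet_crossEvent ..) (by positivity)
    (Finset.card_pos.1 (Nat.cast_pos.1 hcard)) hprob hcov).trans (ENNReal.ofReal_le_ofReal ?_)
  rw [← card_otherPairs i]
  refine le_of_eq ?_
  field_simp
  ring

end SecondMoment

/-! ### The lower bound -/

lemma measure_pi_eq_lintegral_update {ι : Type*} [Fintype ι] [DecidableEq ι] {X : ι → Type*}
    [∀ i, MeasurableSpace (X i)] (μ : ∀ i, Measure (X i)) [∀ i, IsProbabilityMeasure (μ i)] (i : ι)
    {S : Set (∀ i, X i)} (hS : MeasurableSet S) :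
    Measure.pi μ S = ∫⁻ y, Measure.pi μ {x | Function.update x i y ∈ S} ∂(μ i) := by
  have hupdate : Measurable fun p : (∀ i, X i) × X i => Function.update p.1 i p.2 :=
    measurable_update'
  calc Measure.pi μ S = ∫⁻ x, S.indicator 1 x ∂(Measure.pi μ) := (lintegral_indicator_one hS).symm
    _ = ∫⁻ x, ∫⁻ y, S.indicator 1 (Function.update x i y) ∂(μ i) ∂(Measure.pi μ) :=
        lintegral_pi_eq_lintegral_update μ i (measurable_one.indicator hS)
    _ = ∫⁻ y, ∫⁻ x, S.indicator 1 (Function.update x i y) ∂(Measure.pi μ) ∂(μ i) :=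
        lintegral_lintegral_swap ((measurable_one.indicator hS).comp hupdate).aemeasurable
    _ = ∫⁻ y, Measure.pi μ {x | Function.update x i y ∈ S} ∂(μ i) :=
        lintegral_congr fun y => lintegral_indicator_one (hupdate.of_uncurry_right hS)

/-- The samples for which no line through two points other than the point `i` crosses, in the sense
of `Crosses`, the dyadic segment of length `2 ^ (-k)` through the point `i` that is parallel to the
axis `d`. -/
def missedAt (k : ℕ) (d : Fin 2) (i : Fin n) : Set (Fin n → Fin 2 → ℝ) :=
  {P | ∀ x ∈ otherPairs i, ¬ Crosses d (wideSide (P i (1 - d))) (P i (1 - d))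
    (dyadicFloor k (P i d)) ((1 / 2) ^ k) (P x.1) (P x.2)}

lemma measurableSet_missedAt (k : ℕ) (d : Fin 2) (i : Fin n) :
    MeasurableSet (missedAt k d i) := by
  have hcoord := measurable_coord i
  simp only [missedAt, Set.ofPred_forall]
  exact Finset.measurableSet_biInter _ fun x _ =>
    (measurableSet_crosses d _ (measurable_wideSide.comp (hcoord _)) (hcoord _)
      ((measurable_dyadicFloor k).comp (hcoord d)) (measurable_pi_apply x.1)
      (measurable_pi_apply x.2)).compl

lemma measure_missedAt_le (hn : 3 ≤ n) (k : ℕ) (d : Fin 2) (i : Fin n) :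
    uniformSample n (missedAt k d i) ≤
      ENNReal.ofReal (65536 * (1 + 4 * n * (1 / 2) ^ k) / ((n - 1) * (n - 2) * (1 / 2) ^ k)) := by
  have hsquare : ∀ᵐ q ∂uniformSquare, q ∈ Set.Icc (0 : Fin 2 → ℝ) 1 :=
    ae_restrict_mem measurableSet_Icc
  have hupdate (q : Fin 2 → ℝ) : {P | Function.update P i q ∈ missedAt k d i} =
      {P : Fin n → Fin 2 → ℝ | ∀ x ∈ otherPairs i, ¬ Crosses d (wideSide (q (1 - d))) (q (1 - d))
        (dyadicFloor k (q d)) ((1 / 2) ^ k) (P x.1) (P x.2)} := by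
    ext P
    refine forall₂_congr fun x hx => ?_
    obtain ⟨h1, h2, -⟩ := mem_otherPairs.1 hx
    rw [Function.update_self, Function.update_of_ne h1, Function.update_of_ne h2]
  calc uniformSample n (missedAt k d i)
      = ∫⁻ q, uniformSample n {P | Function.update P i q ∈ missedAt k d i} ∂uniformSquare :=
        measure_pi_eq_lintegral_update _ i (measurableSet_missedAt k d i)
    _ ≤ ∫⁻ _, ENNReal.ofReal
          (65536 * (1 + 4 * n * (1 / 2) ^ k) / ((n - 1) * (n - 2) * (1 / 2) ^ k))
          ∂uniformSquare := by
        refine lintegral_mono_ae (hsquare.mono fun q hq => ?_)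
        rw [hupdate]
        exact measure_forall_not_crosses_le ⟨hq.1 _, hq.2 _⟩ (dyadicFloor_nonneg k _)
          (by positivity) (dyadicFloor_add_le_one k _) hn i
    _ = _ := by rw [lintegral_const, measure_univ, mul_one]

namespace DeterminesChirotope

variable {A : Algorithm n}

lemma ae_sum_indicator_le_bitsRead (hA : DeterminesChirotope A) (k : ℕ) :
    ∀ᵐ P ∂uniformSample n, ∑ i, ∑ d, (missedAt k d i)ᶜ.indicator
      (fun _ => ((k + 1 : ℕ) : ℝ≥0∞)) P ≤ bitsRead A (inputOf P) := by
  filter_upwards [hA, ae_mem_Icc, ae_notMem_dyadicEnds] with P ⟨t, ht⟩ hP hd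
  refine le_trans ?_ (size_knowledge_le_bitsRead A (inputOf P) t)
  rw [Knowledge.size, Nat.cast_sum]
  simp only [Nat.cast_sum]
  refine Finset.sum_le_sum fun i _ => Finset.sum_le_sum fun d _ =>
    Set.indicator_apply_le' (fun hcrossed => ?_) fun _ => zero_le
  obtain ⟨x, hx, hcross⟩ : ∃ x ∈ otherPairs i, Crosses d (wideSide (P i (1 - d))) (P i (1 - d))
      (dyadicFloor k (P i d)) ((1 / 2) ^ k) (P x.1) (P x.2) := by
    simpa [missedAt] using hcrossed
  obtain ⟨h1, h2, -⟩ := mem_otherPairs.1 hx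
  exact_mod_cast hA.lt_length_of_crosses (mem_openBox_knowledge A hP hd t) ht h1 h2 hcross

lemma sum_measure_compl_missedAt_le_averageBits (hA : DeterminesChirotope A) (k : ℕ) :
    ∑ i, ∑ d, ((k + 1 : ℕ) : ℝ≥0∞) * uniformSample n (missedAt k d i)ᶜ ≤ averageBits A := by
  have hm (i : Fin n) (d : Fin 2) := (measurableSet_missedAt k d i).compl
  calc ∑ i, ∑ d, ((k + 1 : ℕ) : ℝ≥0∞) * uniformSample n (missedAt k d i)ᶜ
      = ∫⁻ P, ∑ i, ∑ d, (missedAt k d i)ᶜ.indicator (fun _ => ((k + 1 : ℕ) : ℝ≥0∞)) P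
          ∂uniformSample n := by
        simp_rw [lintegral_finsetSum _ fun i _ => Finset.measurable_sum _ fun d _ =>
          measurable_const.indicator (hm i d), lintegral_finsetSum _ fun d _ =>
          measurable_const.indicator (hm _ d), lintegral_indicator_const (hm _ _)]
    _ ≤ averageBits A := lintegral_mono_ae (hA.ae_sum_indicator_le_bitsRead k)

lemma le_averageBits (hA : DeterminesChirotope A) {k : ℕ} {p : ℝ} (hp : 0 ≤ p)
    (hmiss : ∀ d i, uniformSample n (missedAt k d i) ≤ ENNReal.ofReal p) :
    ENNReal.ofReal (2 * n * ((k + 1) * (1 - p))) ≤ averageBits A := by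
  refine le_trans ?_ (hA.sum_measure_compl_missedAt_le_averageBits k)
  have hcompl (i : Fin n) (d : Fin 2) :
      ENNReal.ofReal (1 - p) ≤ uniformSample n (missedAt k d i)ᶜ := by
    rw [prob_compl_eq_one_sub (measurableSet_missedAt k d i), ENNReal.ofReal_sub _ hp,
      ENNReal.ofReal_one]
    exact tsub_le_tsub_left (hmiss d i) 1
  calc ENNReal.ofReal (2 * n * ((k + 1) * (1 - p)))
      = ∑ _i : Fin n, ∑ _d : Fin 2, ((k + 1 : ℕ) : ℝ≥0∞) * ENNReal.ofReal (1 - p) := by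
        rw [ENNReal.ofReal_mul (by positivity), ENNReal.ofReal_mul (by positivity),
          ENNReal.ofReal_mul (by positivity), ← Nat.cast_add_one, ENNReal.ofReal_natCast,
          ENNReal.ofReal_natCast, ENNReal.ofReal_ofNat]
        simp only [Finset.sum_const, Finset.card_univ, Fintype.card_fin, nsmul_eq_mul]
        push_cast
        ring
    _ ≤ _ := by gcongr with i _ d _; exact hcompl i d

end DeterminesChirotope

lemma three_halves_le_logb (hn : 3 ≤ n) : 3 / 2 ≤ Real.logb 2 n := by
  have hn' : (3 : ℝ) ≤ n := by exact_mod_cast hn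
  have h : Real.logb 2 (2 ^ 3) ≤ Real.logb 2 ((n : ℝ) ^ 2) :=
    Real.logb_le_logb_of_le one_lt_two (by norm_num) (by nlinarith)
  rw [Real.logb_pow, Real.logb_pow, Real.logb_self_eq_one one_lt_two] at h
  push_cast at h
  linarith

lemma half_le_logb_logb (hn : 3 ≤ n) : 1 / 2 ≤ Real.logb 2 (Real.logb 2 n) := by
  have h : Real.logb 2 2 ≤ Real.logb 2 (Real.logb 2 n ^ 2) :=
    Real.logb_le_logb_of_le one_lt_two two_pos (by nlinarith [three_halves_le_logb hn])
  rw [Real.logb_pow, Real.logb_self_eq_one one_lt_two] at h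
  push_cast at h
  linarith

lemma exists_resolution (hn : 3 ≤ n) : ∃ k : ℕ,
    2 * Real.logb 2 n - Real.logb 2 (Real.logb 2 n) ≤ k + 1 ∧
    Real.logb 2 n ≤ n ^ 2 * (1 / 2) ^ k ∧ n * (1 / 2 : ℝ) ^ k ≤ 2 := by
  have hn' : (3 : ℝ) ≤ n := by exact_mod_cast hn
  have hL : 0 < Real.logb 2 n := by linarith [three_halves_le_logb hn]
  have h2L : (2 : ℝ) ^ Real.logb 2 n = n := Real.rpow_logb two_pos one_lt_two.ne' (by linarith)
  have hLn : Real.logb 2 n ≤ n := by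
    rw [Real.logb_le_iff_le_rpow one_lt_two (by linarith), Real.rpow_natCast]
    exact_mod_cast Nat.lt_two_pow_self.le
  set L := Real.logb 2 n
  have h2l : (2 : ℝ) ^ Real.logb 2 L = L := Real.rpow_logb two_pos one_lt_two.ne' hL
  have hlL : Real.logb 2 L ≤ L := Real.logb_le_logb_of_le one_lt_two hL hLn
  set l := Real.logb 2 L
  have hpow : (2 : ℝ) ^ (2 * L - l) = n ^ 2 / L := by
    rw [Real.rpow_sub two_pos, h2l, mul_comm, Real.rpow_mul zero_le_two, h2L, Real.rpow_ofNat]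
  have hfloor : (⌊2 * L - l⌋₊ : ℝ) ≤ 2 * L - l := Nat.floor_le (by linarith)
  have hlt : 2 * L - l < ⌊2 * L - l⌋₊ + 1 := Nat.lt_floor_add_one _
  set k := ⌊2 * L - l⌋₊
  have hle : (2 : ℝ) ^ k * L ≤ n ^ 2 := by
    rw [← le_div_iff₀ hL, ← hpow, ← Real.rpow_natCast]
    exact Real.rpow_le_rpow_of_exponent_le one_le_two hfloor
  have hge : n ^ 2 ≤ (2 : ℝ) ^ (k + 1) * L := by
    rw [← div_le_iff₀ hL, ← hpow, ← Real.rpow_natCast]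
    exact Real.rpow_le_rpow_of_exponent_le one_le_two (by exact_mod_cast hlt.le)
  refine ⟨k, hlt.le, ?_, ?_⟩
  · rw [one_div_pow, mul_one_div, le_div_iff₀ (by positivity), mul_comm]
    exact hle
  · rw [one_div_pow, mul_one_div, div_le_iff₀ (by positivity), ← pow_succ']
    have : (n : ℝ) * n ≤ 2 ^ (k + 1) * n := by
      rw [← sq]
      exact hge.trans (by gcongr)
    exact le_of_mul_le_mul_right this (by linarith)

lemma exists_measure_missedAt_le : ∃ c : ℝ, 0 < c ∧ ∀ n : ℕ, 3 ≤ n → ∃ k : ℕ,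
    2 * Real.logb 2 n - Real.logb 2 (Real.logb 2 n) ≤ k + 1 ∧ ∀ (d : Fin 2) (i : Fin n),
      uniformSample n (missedAt k d i) ≤ ENNReal.ofReal (c / Real.logb 2 n) := by
  refine ⟨65536 * 9 * 5, by norm_num, fun n hn => ?_⟩
  obtain ⟨k, hk, hlog, hnδ⟩ := exists_resolution hn
  refine ⟨k, hk, fun d i => (measure_missedAt_le hn k d i).trans (ENNReal.ofReal_le_ofReal ?_)⟩
  have hn' : (3 : ℝ) ≤ n := by exact_mod_cast hn
  have hL : 0 < Real.logb 2 n := by linarith [three_halves_le_logb hn]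
  have hδ : (0 : ℝ) < (1 / 2) ^ k := by positivity
  generalize ((1 : ℝ) / 2) ^ k = δ at *
  have hsq : (n : ℝ) ^ 2 ≤ 5 * ((n - 1) * (n - 2)) := by nlinarith
  have hlog' : Real.logb 2 n ≤ 5 * ((n - 1) * (n - 2) * δ) := by nlinarith
  calc 65536 * (1 + 4 * n * δ) / ((n - 1) * (n - 2) * δ)
      ≤ 65536 * 9 / (Real.logb 2 n / 5) := by gcongr <;> linarith
    _ = 65536 * 9 * 5 / Real.logb 2 n := by field_simp

theorem exists_lower_bound : ∃ C : ℝ, ∀ n : ℕ, 3 ≤ n → ∀ A : Algorithm n, DeterminesChirotope A →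
    ENNReal.ofReal (4 * n * Real.logb 2 n - C * (n * Real.logb 2 (Real.logb 2 n)))
      ≤ averageBits A := by
  obtain ⟨c, hc, hmiss⟩ := exists_measure_missedAt_le
  refine ⟨2 + 8 * c, fun n hn A hA => ?_⟩
  obtain ⟨k, hk, hp⟩ := hmiss n hn
  have hL : 0 < Real.logb 2 n := by linarith [three_halves_le_logb hn]
  have hl : 1 / 2 ≤ Real.logb 2 (Real.logb 2 n) := half_le_logb_logb hn
  refine (ENNReal.ofReal_le_ofReal_iff'.2 ?_).trans (hA.le_averageBits (by positivity) hp)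
  generalize Real.logb 2 (Real.logb 2 n) = l at *
  generalize Real.logb 2 n = L at *
  have hcl : c / 2 ≤ c * l := by nlinarith
  rcases le_total L c with hLc | hcL
  · right
    have : 4 * L - (2 + 8 * c) * l ≤ 0 := by linarith
    nlinarith
  · left
    have hprob : 0 ≤ 1 - c / L := sub_nonneg.2 ((div_le_one hL).2 hcL)
    have hbits : 2 * L - l - 2 * c ≤ (k + 1) * (1 - c / L) := by
      calc 2 * L - l - 2 * c ≤ 2 * L - l - 2 * c + l * (c / L) :=
            le_add_of_nonneg_right (by positivity)
        _ = (2 * L - l) * (1 - c / L) := by field_simp; ring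
        _ ≤ (k + 1) * (1 - c / L) := by gcongr
    calc 4 * n * L - (2 + 8 * c) * (n * l) = 2 * n * (2 * L - l - 4 * (c * l)) := by ring
      _ ≤ 2 * n * ((k + 1) * (1 - c / L)) := by gcongr; linarith

end BitModel

theorem theorem1 :
    -- (i) every algorithm that determines the chirotope
    (∃ C : ℝ, ∀ n : ℕ, 3 ≤ n → ∀ A : Algorithm n, DeterminesChirotope A →
      ENNReal.ofReal (4 * n * Real.logb 2 n - C * (n * Real.logb 2 (Real.logb 2 n)))
        ≤ averageBits A) ∧
    -- (ii) there is a greedy algorithm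
    (∃ A : ∀ n, Algorithm n, UniformlyComputable A ∧ ∀ n, IsGreedy (A n)) ∧
    -- and every greedy algorithm, whatever its rule to break ties, has the required properties
    (∀ (n : ℕ) (A : Algorithm n), IsGreedy A →
      DeterminesChirotope A ∧
      (∀ w : Input n, InGeneralPosition w.points → Outputs A w (chirotope w.points)) ∧
      averageBits A ≤ ENNReal.ofReal (4 * n * Real.logb 2 n + 16 * n)) :=
  ⟨exists_lower_bound,
    ⟨greedyAlgorithm, uniformlyComputable_greedyAlgorithm, isGreedy_greedyAlgorithm⟩,
    fun _ _ hA => ⟨hA.determinesChirotope, hA.outputs_of_inGeneralPosition, hA.averageBits_le⟩⟩
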